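/- All balls are closed. Let $(X,d)$ be a metric space that is doubling, i.e. there is an integer $K$ such that for every $r>0$ every ball of radius $r$ in $X$ is covered by at most $K$ balls of radius $r/2$. For $\eta>0$, a set $S\subseteq X$ is $\eta$-round if it has finite diameter and for every $v\in S$ and every $0\le r\le \operatorname{diam}(S)$ there is $v'\in S$ with $B(v',\eta r)\subseteq S\cap B(v,r)$. The intersection graph of a (possibly infinite) system $\mathcal S$ of subsets of $X$ has vertex set $\mathcal S$, two distinct members being adjacent if and only if they intersect; a graph is regarded as a space with the shortest-path distance (infinite between different components). For an integer $n\ge 0$, a function $D:\mathbb R_+\to\mathbb R_+$ is an $n$-dimensional control function for a space $Y$ if for every $r>0$ there is a cover $\mathcal U=\bigcup_{i=1}^{n+1}\mathcal U_i$ of $Y$ such that each $\mathcal U_i$ consists of pairwise disjoint sets, every element of $\mathcal U$ has diameter at most $D(r)$, and the Lebesgue number of $\mathcal U$ (the supremum of all $\rho\ge 0$ such that every ball of radius $\rho$ is contained in an element of $\mathcal U$) is at least $r$. The Assouad–Nagata dimension of $X$ is the least $n$ for which $D(r)=Cr$ is an $n$-dimensional control function for $X$ for some $C>1$. The asymptotic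 dimension of a class of graphs is the least $n$ for which a single function $D$ is an $n$-dimensional control function for all graphs in the class ($\infty$ if there is no such $n$). **Corollary.** For every $\eta>0$ and every doubling metric space $(X,d)$, the class $\mathcal G$ of intersection graphs of systems of $\eta$-round subsets of $X$ has finite asymptotic dimension. If, additionally, $(X,d)$ has Assouad–Nagata dimension $n$, then $\mathcal G$ has asymptotic dimension at most $2n+1$. -/

import Mathlib

open scoped ENNReal NNReal

universe u

/-! ### Control functions and dimensions of (extended) metric spaces

Distances may be infinite, so that disconnected graphs are covered too. Balls are closed. -/

/-- The Lebesgue number of a collection `𝓤` of subsets of `X`: the supremum of all `r ≥ 0` such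
that every ball of radius `r` is contained in some member of `𝓤`. -/
noncomputable def lebesgueNumberOf {X : Type*} [PseudoEMetricSpace X] (𝓤 : Set (Set X)) : ℝ≥0∞ :=
  ⨆ (r : ℝ≥0) (_ : ∀ x : X, ∃ U ∈ 𝓤, Metric.closedEBall x (r : ℝ≥0∞) ⊆ U), (r : ℝ≥0∞)

/-- The mesh of a collection `𝓤`: the supremum of the diameters of its members. -/
noncomputable def meshOf {X : Type*} [PseudoEMetricSpace X] (𝓤 : Set (Set X)) : ℝ≥0∞ :=
  ⨆ U ∈ 𝓤, Metric.ediam U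

/-- `D` is an `n`-dimensional control function for `X`: for every `r > 0` there is a cover of `X`,
a union of `n + 1` collections each consisting of pairwise disjoint sets, whose mesh is at most
`D r` and whose Lebesgue number is at least `r`. -/
def IsControlFunction (X : Type*) [PseudoEMetricSpace X] (n : ℕ) (D : ℝ≥0 → ℝ≥0) : Prop :=
  ∀ r : ℝ≥0, 0 < r → ∃ 𝓤 : Fin (n + 1) → Set (Set X),
    ⋃₀ (⋃ i, 𝓤 i) = Set.univ ∧
    (∀ i, (𝓤 i).PairwiseDisjoint id) ∧
    meshOf (⋃ i, 𝓤 i) ≤ (D r : ℝ≥0∞) ∧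
    (r : ℝ≥0∞) ≤ lebesgueNumberOf (⋃ i, 𝓤 i)

/-- The Assouad–Nagata dimension of `X`: the least `n` such that `r ↦ K * r` is an
`n`-dimensional control function for `X` for some `K > 1` (and `⊤` if there is none). -/
noncomputable def assouadNagataDim (X : Type*) [PseudoEMetricSpace X] : ℕ∞ :=
  ⨅ (n : ℕ) (_ : ∃ K : ℝ≥0, 1 < K ∧ IsControlFunction X n (fun r => K * r)), (n : ℕ∞)

/-! ### Graph classes -/

/-- The shortest-path metric of a graph; vertices in different components are at infinite
distance. -/
@[reducible] noncomputable def SimpleGraph.pathEMetricSpace {V : Type*} (G : SimpleGraph V) :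
    PseudoEMetricSpace V where
  edist u v := (G.edist u v : ℝ≥0∞)
  edist_self u := by simp
  edist_comm u v := by rw [SimpleGraph.edist_comm]
  edist_triangle u v w := by
    exact_mod_cast SimpleGraph.edist_triangle (G := G) (u := u) (v := v) (w := w)

/-- A class of (possibly infinite) graphs. -/
abbrev GraphClass : Type (u + 1) := Set (Σ V : Type u, SimpleGraph V)

/-- The asymptotic dimension of a class of graphs: the least `n` such that a single function `D` is
an `n`-dimensional control function for all graphs of the class (and `⊤` if there is none). -/
noncomputable def asymptoticDim (𝒢 : GraphClass.{u}) : ℕ∞ :=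
  ⨅ (n : ℕ) (_ : ∃ D : ℝ≥0 → ℝ≥0, ∀ G ∈ 𝒢,
    @IsControlFunction G.1 G.2.pathEMetricSpace n D), (n : ℕ∞)

/-- The intersection graph of a system `𝒮` of sets: the vertices are the members of `𝒮`, and two
distinct members are adjacent if and only if they intersect. -/
def intersectionGraph {X : Type*} (𝒮 : Set (Set X)) : SimpleGraph 𝒮 where
  Adj S T := S ≠ T ∧ ((S : Set X) ∩ (T : Set X)).Nonempty
  symm := ⟨fun _ _ h => ⟨h.1.symm, by rw [Set.inter_comm]; exact h.2⟩⟩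
  loopless := ⟨fun _ h => h.1 rfl⟩

/-! ### Doubling spaces and round sets -/

/-- `X` is a doubling space: for some `K`, every ball of radius `r > 0` is covered by at most `K`
balls of radius `r / 2`. -/
def IsDoublingSpace (X : Type*) [MetricSpace X] : Prop :=
  ∃ K : ℕ, ∀ r : ℝ, 0 < r → ∀ x : X, ∃ t : Finset X, t.card ≤ K ∧
    Metric.closedBall x r ⊆ ⋃ c ∈ t, Metric.closedBall c (r / 2)

/-- `S` is `η`-round: it has finite diameter and, for all `v ∈ S` and all `r ≤ diam S`, some ball
of radius `η * r` centred in `S` is contained in `S` and in the ball of radius `r` around `v`. -/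
def IsRound {X : Type*} [MetricSpace X] (η : ℝ) (S : Set X) : Prop :=
  Bornology.IsBounded S ∧
    ∀ v ∈ S, ∀ r : ℝ, 0 ≤ r → r ≤ Metric.diam S →
      ∃ v' ∈ S, Metric.closedBall v' (η * r) ⊆ S ∩ Metric.closedBall v r

/-- The family of all intersection graphs of systems of `η`-round subsets of `X`. -/
def roundIntersectionGraphs (X : Type u) [MetricSpace X] (η : ℝ) : GraphClass.{u} :=
  {G | ∃ 𝒮 : Set (Set X), (∀ S ∈ 𝒮, IsRound η S) ∧ G = ⟨𝒮, intersectionGraph 𝒮⟩}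

/-! ### Chains in graphs -/

section Chains

variable {V : Type u} {G : SimpleGraph V}

/-! Since balls in a graph are easy to thicken, it suffices to colour the vertices, for each step
length `r`, with `2 * (n + 1)` colours so that monochromatic `r`-chains have bounded endpoints'
distance (`isControlFunction_of_isChainBounded`). The colour is a pair.

The first coordinate comes from the space. A vertex `v` gets as scale the order of magnitude of the
largest diameter among the sets within graph distance `r`, and as position a point of such a largest
set. It takes one of the `n + 1` colours of a cover of `X` at that scale. If the scales grow fast
enough, chains of equally coloured nearby vertices of scale at most `j` remain in a region of size
comparable to scale `j` (`dist_le_of_chain_closeAtScales`). The resulting clusters are nested, hence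
form a forest.

The second coordinate deals with chains that mix scales. A vertex stays in the bag of its cluster at
scale `j` while some equally coloured vertex nearby has scale at least `j`. Every vertex of a bag is
then close in the graph to a set of diameter at least the scale, located in a bounded region. By
roundness and doubling only boundedly many such sets are disjoint (`exists_packing_bound`), so a bag
is covered by boundedly many graph balls. As for graphs of bounded tree-width, two more colours
suffice along such a forest (`BagForest.exists_colouring`).

Largest sets and extreme scales exist if only finitely many diameters occur; compactness
(`exists_isChainBounded_of_finset`) removes this restriction. For finite dimension without further
hypothesis, a doubling space has a linear control function of some dimension. -/

theorem edist_le_add {x y z : V} {a b : ℕ} (h : G.edist x y ≤ a) (h' : G.edist y z ≤ b) :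
    G.edist x z ≤ (a + b : ℕ) := by
  push_cast
  exact G.edist_triangle.trans (add_le_add h h')

theorem edist_le_symm {x y : V} {a : ℕ} (h : G.edist x y ≤ a) : G.edist y x ≤ a := by
  rwa [SimpleGraph.edist_comm]

theorem edist_le_mono {x y : V} {a b : ℕ} (h : G.edist x y ≤ a) (hab : a ≤ b) :
    G.edist x y ≤ b :=
  h.trans (by exact_mod_cast hab)

/-- The last point of a chain at which `P` holds. -/
theorem exists_last_of_chain {E : V → V → Prop} {P : V → Prop} {u v : V}
    (h : Relation.ReflTransGen E u v) (hu : P u) :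
    ∃ x, P x ∧ (x = v ∨
      ∃ y, E x y ∧ ¬ P y ∧ Relation.ReflTransGen (fun a b => E a b ∧ ¬ P a ∧ ¬ P b) y v) := by
  induction h with
  | refl => exact ⟨u, hu, Or.inl rfl⟩
  | @tail b c _ hbc ih =>
    by_cases hc : P c
    · exact ⟨c, hc, Or.inl rfl⟩
    · obtain ⟨x, hx, rfl | ⟨y, hxy, hy, hyb⟩⟩ := ih
      · exact ⟨x, hx, Or.inr ⟨c, hbc, hc, .refl⟩⟩
      · refine ⟨x, hx, Or.inr ⟨y, hxy, hy, hyb.tail ⟨hbc, ?_, hc⟩⟩⟩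
        obtain rfl | ⟨z, _, hz⟩ := Relation.ReflTransGen.cases_tail hyb
        · exact hy
        · exact hz.2.2

/-- A chain with short steps inside a union of few balls has close endpoints. -/
theorem edist_le_of_chain_of_cover {s K : ℕ} (F : Finset V) (E : V → V → Prop) (S : V → Prop)
    (hE : ∀ x y, E x y → G.edist x y ≤ s ∧ S x ∧ S y)
    (hS : ∀ x, S x → ∃ f ∈ F, G.edist x f ≤ K) {u v : V}
    (h : Relation.ReflTransGen E u v) (hu : S u) :
    G.edist u v ≤ (F.card * (2 * K + s) : ℕ) := by
  classical
  induction hn : F.card generalizing F E S u with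
  | zero =>
    obtain ⟨f, hf, _⟩ := hS u hu
    rw [Finset.card_eq_zero] at hn
    simp [hn] at hf
  | succ n ih =>
    obtain ⟨f, hf, huf⟩ := hS u hu
    -- Jump to the last point of the chain in the ball around `f`, at cost `2 * K`; after one more
    -- step the chain avoids this ball, which leaves one ball fewer.
    obtain ⟨x, hx, hxv⟩ := exists_last_of_chain (P := fun y => G.edist y f ≤ K) h huf
    have hux := edist_le_add huf (edist_le_symm hx)
    obtain rfl | ⟨y, hxy, hy, hyv⟩ := hxv
    · exact edist_le_mono hux (by ring_nf; omega)
    · have := ih (F.erase f) (fun a b => E a b ∧ ¬ G.edist a f ≤ K ∧ ¬ G.edist b f ≤ K)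
        (fun a => S a ∧ ¬ G.edist a f ≤ K)
        (fun a b hab => ⟨(hE a b hab.1).1, ⟨(hE a b hab.1).2.1, hab.2.1⟩,
          (hE a b hab.1).2.2, hab.2.2⟩)
        (fun a ha => by
          obtain ⟨g, hg, hag⟩ := hS a ha.1
          refine ⟨g, Finset.mem_erase.2 ⟨?_, hg⟩, hag⟩
          rintro rfl
          exact ha.2 hag)
        hyv ⟨(hE x y hxy).2.2, hy⟩ (by rw [Finset.card_erase_of_mem hf, hn]; rfl)
      refine edist_le_mono (edist_le_add (edist_le_add hux (hE x y hxy).1) this) ?_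
      ring_nf; omega

end Chains

/-! ### Two-colouring along a forest of bags -/

/-- A rooted forest on `T`, with a bag of points of `V` at every node, such that the nodes whose
bags contain a given point are joined to a common top node by nodes with the same property. -/
structure BagForest (V T : Type u) where
  parent : T → T
  level : T → ℕ
  bag : T → Set V
  top : V → T
  level_parent : ∀ t, level t ≠ 0 → level (parent t) + 1 = level t
  mem_parent : ∀ v t, v ∈ bag t → t ≠ top v → level t ≠ 0 ∧ v ∈ bag (parent t)

namespace BagForest

variable {V T : Type u} (B : BagForest V T) (G : SimpleGraph V)

/-- Two points in a common bag at distance at most `r`. -/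
def Linked (r : ℕ) (u v : V) : Prop :=
  (∃ t, u ∈ B.bag t ∧ v ∈ B.bag t) ∧ G.edist u v ≤ r

/-- Every bag is a union of at most `N` sets contained in balls of radius `ρ`. -/
def Covered (N ρ : ℕ) : Prop :=
  ∀ t, ∃ F : Finset V, F.card ≤ N ∧ ∀ v ∈ B.bag t, ∃ f ∈ F, G.edist v f ≤ ρ

/-- The bags at `s` and `t` are at distance at most `K`. -/
def NearBags (K : ℕ) (t s : T) : Prop :=
  ∃ y ∈ B.bag t, ∃ z ∈ B.bag s, G.edist y z ≤ K

-- The numerical argument is meant to be the level of the node; it bounds the climb towards the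
-- root.
open Classical in
noncomputable def anchorAux (K : ℕ) : ℕ → T → T
  | 0, t => t
  | n + 1, t =>
    if B.NearBags G K t (anchorAux K n (B.parent t)) then anchorAux K n (B.parent t) else t

/-- The root of the piece of `t`, where a node belongs to the piece of its parent when its bag is
close to the bag at the root of that piece, and otherwise starts a new piece. -/
noncomputable def anchor (K : ℕ) (t : T) : T := B.anchorAux G K (B.level t) t

variable {B G}

theorem anchor_of_level_eq_zero {K : ℕ} {t : T} (h : B.level t = 0) : B.anchor G K t = t := by
  rw [anchor, h, anchorAux]

theorem anchor_of_near {K : ℕ} {t : T} (h : B.level t ≠ 0)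
    (hn : B.NearBags G K t (B.anchor G K (B.parent t))) :
    B.anchor G K t = B.anchor G K (B.parent t) := by
  have h' := B.level_parent t h
  unfold anchor at hn ⊢
  rw [← h', anchorAux, if_pos hn]

theorem anchor_of_not_near {K : ℕ} {t : T} (h : B.level t ≠ 0)
    (hn : ¬ B.NearBags G K t (B.anchor G K (B.parent t))) : B.anchor G K t = t := by
  have h' := B.level_parent t h
  unfold anchor at hn ⊢
  rw [← h', anchorAux, if_neg hn]

theorem nearBags_anchor {K : ℕ} {t : T} {v : V} (hv : v ∈ B.bag t) :
    B.NearBags G K t (B.anchor G K t) := by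
  have self : B.NearBags G K t t := ⟨v, hv, v, hv, by simp⟩
  by_cases h : B.level t = 0
  · rwa [anchor_of_level_eq_zero h]
  · by_cases hn : B.NearBags G K t (B.anchor G K (B.parent t))
    · rwa [anchor_of_near h hn]
    · rwa [anchor_of_not_near h hn]

variable (B G) in
/-- The piece of a point. -/
noncomputable def piece (K : ℕ) (v : V) : T := B.anchor G K (B.top v)

variable (B G) in
/-- The point `v` lies within distance `k` of the bag at the root of its piece. -/
def NearRoot (K k : ℕ) (v : V) : Prop :=
  ∃ z ∈ B.bag (B.piece G K v), G.edist v z ≤ k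

variable (B G) in
/-- The piece with root `b` hangs off the piece of `v`, and its attaching bags contain `v`. -/
structure Above (K : ℕ) (v : V) (b : T) : Prop where
  mem : v ∈ B.bag b
  mem_parent : v ∈ B.bag (B.parent b)
  anchor_parent : B.anchor G K (B.parent b) = B.piece G K v
  far : ¬ B.NearRoot G K K v

/-- Going down from the top node of `v`, a new piece can start at most once while `v` remains in the
bags: the new root bag contains `v`, so every later bag containing `v` is at distance zero from it.
Thus a point meets only its own piece and pieces hanging directly below. -/
theorem anchor_eq_piece_or_above {K : ℕ} {t : T} {v : V} (hv : v ∈ B.bag t) :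
    B.anchor G K t = B.piece G K v ∨ B.Above G K v (B.anchor G K t) := by
  induction hn : B.level t generalizing t with
  | zero =>
    by_cases ht : t = B.top v
    · left; rw [ht]; rfl
    · exact absurd hn (B.mem_parent v t hv ht).1
  | succ n ih =>
    by_cases ht : t = B.top v
    · left; rw [ht]; rfl
    obtain ⟨hl, hp⟩ := B.mem_parent v t hv ht
    have hlp := B.level_parent t hl
    have ihp := ih hp (by omega)
    by_cases hnear : B.NearBags G K t (B.anchor G K (B.parent t))
    · rwa [anchor_of_near hl hnear]
    · rw [anchor_of_not_near hl hnear]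
      right
      rcases ihp with h | h
      · refine ⟨hv, hp, h, ?_⟩
        rintro ⟨z, hz, hvz⟩
        exact hnear ⟨v, hv, z, h ▸ hz, hvz⟩
      · exact absurd ⟨v, hv, v, h.mem, by simp⟩ hnear

/-- Apply the dichotomy for a common bag to both points. If both are above its piece, both lie in
the bag at the parent of the root of that piece, which belongs to the piece of each. -/
theorem Linked.cases {K r : ℕ} {u v : V} (h : B.Linked G r u v) :
    (B.piece G K u = B.piece G K v ∧
      ∃ t, B.anchor G K t = B.piece G K u ∧ u ∈ B.bag t ∧ v ∈ B.bag t) ∨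
    B.Above G K u (B.piece G K v) ∨ B.Above G K v (B.piece G K u) := by
  obtain ⟨⟨t, hu, hv⟩, _⟩ := h
  rcases anchor_eq_piece_or_above (G := G) (K := K) hu with hu' | hu' <;>
    rcases anchor_eq_piece_or_above (G := G) (K := K) hv with hv' | hv'
  · exact Or.inl ⟨hu'.symm.trans hv', t, hu', hu, hv⟩
  · exact Or.inr (Or.inr (hu' ▸ hv'))
  · exact Or.inr (Or.inl (hv' ▸ hu'))
  · exact Or.inl ⟨hu'.anchor_parent.symm.trans hv'.anchor_parent, _, hu'.anchor_parent,
      hu'.mem_parent, hv'.mem_parent⟩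

theorem Linked.symm {r : ℕ} {u v : V} (h : B.Linked G r u v) : B.Linked G r v u :=
  ⟨h.1.imp fun _ ht => ⟨ht.2, ht.1⟩, edist_le_symm h.2⟩

variable (B G) in
/-- The bags left after removing from each piece a neighbourhood of the bag at its root. -/
noncomputable def trim (K k : ℕ) : BagForest V T where
  parent := B.parent
  level := B.level
  bag t := {v | v ∈ B.bag t ∧ B.anchor G K t = B.piece G K v ∧ ¬ B.NearRoot G K k v}
  top := B.top
  level_parent := B.level_parent
  mem_parent := by
    rintro v t ⟨hv, ha, hf⟩ ht
    obtain ⟨hl, hp⟩ := B.mem_parent v t hv ht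
    refine ⟨hl, hp, ?_, hf⟩
    rcases anchor_eq_piece_or_above (G := G) (K := K) hp with h | h
    · exact h
    · by_cases hnear : B.NearBags G K t (B.anchor G K (B.parent t))
      · rw [← ha, anchor_of_near hl hnear]
      · exact absurd ⟨v, hv, v, h.mem, by simp⟩ hnear

/-- A bag lies within `K` of the bag at the root of its piece. The covering ball that contains the
witness of this has diameter at most `2 * ρ`, so trimming at `K + 2 * ρ` removes all of it from the
bag and one ball is saved. This drives the induction on the number of balls. -/
theorem Covered.trim {N ρ K : ℕ} (h : B.Covered G (N + 1) ρ) :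
    (B.trim G K (K + 2 * ρ)).Covered G N ρ := by
  classical
  intro t
  obtain ⟨F, hF, hc⟩ := h t
  by_cases hne : ∃ v, v ∈ B.bag t
  · obtain ⟨v, hv⟩ := hne
    obtain ⟨y, hy, z, hz, hyz⟩ := nearBags_anchor (G := G) (K := K) hv
    obtain ⟨f, hf, hyf⟩ := hc y hy
    refine ⟨F.erase f, by rw [Finset.card_erase_of_mem hf]; omega, ?_⟩
    rintro w ⟨hw, hwa, hwf⟩
    obtain ⟨g, hg, hwg⟩ := hc w hw
    refine ⟨g, Finset.mem_erase.2 ⟨?_, hg⟩, hwg⟩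
    rintro rfl
    refine hwf ⟨z, hwa ▸ hz, ?_⟩
    exact edist_le_mono (edist_le_add (edist_le_add hwg (edist_le_symm hyf)) hyz) (by omega)
  · exact ⟨∅, by simp, fun v hv => absurd ⟨v, hv.1⟩ hne⟩

variable (B G) in
/-- The points close to a point of the piece above. -/
def Layer (K r : ℕ) (v : V) : Prop :=
  ∃ u, G.edist v u ≤ r ∧ B.Above G K u (B.piece G K v)

theorem Layer.nearRoot {K r : ℕ} {v : V} (h : B.Layer G K r v) : B.NearRoot G K r v := by
  obtain ⟨u, hu, ha⟩ := h
  exact ⟨u, ha.mem, hu⟩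

theorem NearRoot.mono {K k l : ℕ} {v : V} (h : B.NearRoot G K k v) (hkl : k ≤ l) :
    B.NearRoot G K l v := by
  obtain ⟨z, hz, hvz⟩ := h
  exact ⟨z, hz, edist_le_mono hvz hkl⟩

theorem NearRoot.of_edist {K k l : ℕ} {v w : V} (h : B.NearRoot G K k v)
    (hp : B.piece G K v = B.piece G K w) (hw : G.edist w v ≤ l) :
    B.NearRoot G K (l + k) w := by
  obtain ⟨z, hz, hvz⟩ := h
  exact ⟨z, hp ▸ hz, edist_le_add hw hvz⟩

/-- A set of points of one piece near its root is covered by few balls. -/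
theorem Covered.nearRoot {N ρ K k : ℕ} (h : B.Covered G N ρ) (b : T) :
    ∃ F : Finset V, F.card ≤ N ∧
      ∀ v, B.piece G K v = b → B.NearRoot G K k v → ∃ f ∈ F, G.edist v f ≤ (k + ρ : ℕ) := by
  obtain ⟨F, hF, hc⟩ := h b
  refine ⟨F, hF, ?_⟩
  rintro v rfl ⟨z, hz, hvz⟩
  obtain ⟨f, hf, hzf⟩ := hc z hz
  exact ⟨f, hf, edist_le_add hvz hzf⟩

open Classical in
variable (B G) in
/-- The colouring of the layers and the neighbourhoods of the roots of the pieces, and by `c`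
elsewhere. -/
noncomputable def extendColouring (K k r : ℕ) (c : V → Bool) (v : V) : Bool :=
  if B.Layer G K r v then true else if B.NearRoot G K k v then false else c v

theorem extendColouring_eq_false {K k r : ℕ} {c : V → Bool} {v : V}
    (h : B.extendColouring G K k r c v = false) :
    ¬ B.Layer G K r v ∧ (B.NearRoot G K k v ∨ ¬ B.NearRoot G K k v ∧ c v = false) := by
  unfold extendColouring at h
  split_ifs at h with h1 h2
  · exact ⟨h1, Or.inl h2⟩
  · exact ⟨h1, Or.inr ⟨h2, h⟩⟩

theorem extendColouring_eq_true {K k r : ℕ} {c : V → Bool} {v : V}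
    (h : B.extendColouring G K k r c v = true) :
    B.Layer G K r v ∨ ¬ B.Layer G K r v ∧ ¬ B.NearRoot G K k v ∧ c v = true := by
  unfold extendColouring at h
  split_ifs at h with h1 h2
  · exact Or.inl h1
  · exact Or.inr ⟨h1, h2, h⟩

/-- Linked points outside the layers lie in the same piece. -/
theorem Linked.piece_eq {K r : ℕ} {u v : V} (h : B.Linked G r u v) (hu : ¬ B.Layer G K r u)
    (hv : ¬ B.Layer G K r v) :
    B.piece G K u = B.piece G K v ∧
      ∃ t, B.anchor G K t = B.piece G K u ∧ u ∈ B.bag t ∧ v ∈ B.bag t := by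
  rcases h.cases (K := K) with h' | h' | h'
  · exact h'
  · exact absurd ⟨u, edist_le_symm h.2, h'⟩ hv
  · exact absurd ⟨v, h.2, h'⟩ hu

theorem Linked.trim {K k r s : ℕ} {u v : V} (h : B.Linked G r u v) (hu : ¬ B.Layer G K r u)
    (hv : ¬ B.Layer G K r v) (hu' : ¬ B.NearRoot G K k u) (hv' : ¬ B.NearRoot G K k v)
    (hrs : r ≤ s) : (B.trim G K k).Linked G s u v := by
  obtain ⟨hp, t, ht, hut, hvt⟩ := h.piece_eq hu hv
  exact ⟨⟨t, ⟨hut, ht, hu'⟩, ⟨hvt, ht.trans hp, hv'⟩⟩, edist_le_mono h.2 hrs⟩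

end BagForest

theorem Relation.ReflTransGen.of_colour {V C : Type*} {R : V → V → Prop} {c : V → C} {b : C}
    {u v : V} (h : Relation.ReflTransGen (fun x y => R x y ∧ c x = c y) u v) (hu : c u = b) :
    Relation.ReflTransGen (fun x y => R x y ∧ c x = b ∧ c y = b) u v ∧ c v = b := by
  induction h with
  | refl => exact ⟨.refl, hu⟩
  | tail _ h ih => exact ⟨ih.1.tail ⟨h.1, ih.2, h.2 ▸ ih.2⟩, h.2 ▸ ih.2⟩

theorem Relation.ReflTransGen.swap_of_symm {V : Type*} {R : V → V → Prop}
    (hR : ∀ x y, R x y → R y x) {u v : V} (h : Relation.ReflTransGen R u v) :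
    Relation.ReflTransGen R v u := by
  induction h with
  | refl => exact .refl
  | tail _ h ih => exact ih.head (hR _ _ h)

/-! ### Extending a two-colouring from the trimmed forest -/

namespace BagForest

variable {V T : Type u} {B : BagForest V T} {G : SimpleGraph V}

section Extend

variable {K k r s N ρ D : ℕ} {c : V → Bool}

/-- A chain of colour `false` avoids the layers, hence stays in one piece. Either it never comes
near the root bag and is a chain for `c`, or all its points are within `D + r + k` of the root bag,
whose few covering balls bound the chain. -/
theorem edist_le_of_chain_false (hB : B.Covered G N ρ) (hrs : r ≤ s)
    (hc : ∀ u v, Relation.ReflTransGen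
      (fun x y => (B.trim G K k).Linked G s x y ∧ c x = c y) u v → G.edist u v ≤ D) {u v : V}
    (h : Relation.ReflTransGen (fun x y => B.Linked G r x y ∧
      B.extendColouring G K k r c x = false ∧ B.extendColouring G K k r c y = false) u v) :
    G.edist u v ≤ (N * (2 * (D + r + k + ρ) + r) + D : ℕ) := by
  set E : V → V → Prop := fun x y => B.Linked G r x y ∧
      B.extendColouring G K k r c x = false ∧ B.extendColouring G K k r c y = false with hE
  set E' : V → V → Prop := fun x y => (B.trim G K k).Linked G s x y ∧ c x = c y with hE'
  have Esymm : ∀ x y, E x y → E y x := fun x y h => ⟨h.1.symm, h.2.2, h.2.1⟩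
  have piece_step : ∀ x y, E x y → B.piece G K x = B.piece G K y := fun x y h =>
    (h.1.piece_eq (extendColouring_eq_false h.2.1).1 (extendColouring_eq_false h.2.2).1).1
  have step : ∀ x y, E x y → ¬ B.NearRoot G K k x → ¬ B.NearRoot G K k y → E' x y := by
    intro x y h hx hy
    obtain ⟨hxl, hx'⟩ := extendColouring_eq_false h.2.1
    obtain ⟨hyl, hy'⟩ := extendColouring_eq_false h.2.2
    refine ⟨h.1.trim hxl hyl hx hy hrs, ?_⟩
    rw [(hx'.resolve_left hx).2, (hy'.resolve_left hy).2]
  have piece_chain : ∀ x y, Relation.ReflTransGen E x y → B.piece G K x = B.piece G K y := by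
    intro x y h
    induction h with
    | refl => rfl
    | tail _ h ih => exact ih.trans (piece_step _ _ h)
  by_cases hm : ∃ m, Relation.ReflTransGen E u m ∧ B.NearRoot G K k m
  · obtain ⟨m, hum, hm⟩ := hm
    -- Up to the first visit near the root, the chain is a `c`-monochromatic chain of the trimmed
    -- forest.
    have key : ∀ w, Relation.ReflTransGen E w m → B.NearRoot G K k w ∨
        ∃ x m', Relation.ReflTransGen E' w x ∧ E x m' ∧ B.NearRoot G K k m' := by
      intro w hw
      induction hw using Relation.ReflTransGen.head_induction_on with
      | refl => exact Or.inl hm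
      | @head w w' hww' _ ih =>
        by_cases hwn : B.NearRoot G K k w
        · exact Or.inl hwn
        by_cases hwn' : B.NearRoot G K k w'
        · exact Or.inr ⟨w, w', .refl, hww', hwn'⟩
        · obtain ⟨x, m', h1, h2, h3⟩ := ih.resolve_left hwn'
          exact Or.inr ⟨x, m', h1.head (step _ _ hww' hwn hwn'), h2, h3⟩
    have near : ∀ w, Relation.ReflTransGen E w m → B.NearRoot G K (D + r + k) w := by
      intro w hw
      rcases key w hw with h | ⟨x, m', h1, h2, h3⟩
      · exact h.mono (by omega)
      · refine h3.of_edist ?_ (edist_le_add (hc _ _ h1) h2.1.2)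
        rw [piece_chain w m hw, ← piece_chain u m hum]
        have hmm : Relation.ReflTransGen E x m' := .single h2
        have hwx : B.piece G K w = B.piece G K x := by
          clear h2 hmm
          induction h1 with
          | refl => rfl
          | tail _ h ih =>
            obtain ⟨⟨⟨t, h1, h2⟩, _⟩, _⟩ := h
            exact ih.trans (h1.2.1.symm.trans h2.2.1)
        rw [piece_chain u m hum, ← piece_chain w m hw, hwx, piece_chain _ _ hmm]
    obtain ⟨F, hF, hcov⟩ := hB.nearRoot (K := K) (k := D + r + k) (B.piece G K u)
    have hS : ∀ x, Relation.ReflTransGen E u x → ∃ f ∈ F, G.edist x f ≤ (D + r + k + ρ : ℕ) :=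
      fun x hx => hcov x (piece_chain _ _ hx).symm
        (near x ((hx.swap_of_symm Esymm).trans hum))
    have hchain : Relation.ReflTransGen (fun x y => G.edist x y ≤ r ∧
        Relation.ReflTransGen E u x ∧ Relation.ReflTransGen E u y) u v := by
      clear hm
      induction h with
      | refl => exact .refl
      | tail h1 h2 ih => exact ih.tail ⟨h2.1.2, h1, h1.tail h2⟩
    refine edist_le_mono (edist_le_of_chain_of_cover F _ _ (fun x y h => h) hS hchain .refl) ?_
    exact (Nat.mul_le_mul_right _ hF).trans (Nat.le_add_right _ _)
  · push Not at hm
    have : Relation.ReflTransGen E' u v := by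
      induction h with
      | refl => exact .refl
      | tail h1 h2 ih => exact ih.tail (step _ _ h2 (hm _ h1) (hm _ (h1.tail h2)))
    exact edist_le_mono (hc _ _ this) (Nat.le_add_left _ _)

/-- Layer points are within `r ≤ K` of their root bag, while a point above another piece is farther
than `K` from its own root bag. So linked layer points share a piece, and the chain lies near a
single root bag. -/
theorem edist_le_of_chain_layer (hB : B.Covered G N ρ) (hrK : r ≤ K) {u v : V}
    (h : Relation.ReflTransGen (fun x y => B.Linked G r x y ∧ B.Layer G K r x ∧
      B.Layer G K r y) u v) (hu : B.Layer G K r u) :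
    B.piece G K u = B.piece G K v ∧ G.edist u v ≤ (N * (2 * (r + ρ) + r) : ℕ) := by
  have hchain : B.piece G K u = B.piece G K v ∧
      Relation.ReflTransGen (fun x y => G.edist x y ≤ r ∧
      (B.piece G K x = B.piece G K u ∧ B.Layer G K r x) ∧
      (B.piece G K y = B.piece G K u ∧ B.Layer G K r y)) u v := by
    induction h with
    | refl => exact ⟨rfl, .refl⟩
    | @tail x y _ h2 ih =>
      have hp : B.piece G K x = B.piece G K y := by
        rcases h2.1.cases (K := K) with h' | h' | h'
        · exact h'.1
        · exact absurd (h2.2.1.nearRoot.mono hrK) h'.far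
        · exact absurd (h2.2.2.nearRoot.mono hrK) h'.far
      exact ⟨ih.1.trans hp, ih.2.tail ⟨h2.1.2, ⟨ih.1.symm, h2.2.1⟩,
        ⟨(ih.1.trans hp).symm, h2.2.2⟩⟩⟩
  obtain ⟨F, hF, hcov⟩ := hB.nearRoot (K := K) (k := r) (B.piece G K u)
  refine ⟨hchain.1, edist_le_mono (edist_le_of_chain_of_cover F _ _ (fun x y h => h)
    (fun x hx => hcov x hx.1 hx.2.nearRoot) hchain.2 ⟨rfl, hu⟩) ?_⟩
  exact Nat.mul_le_mul_right _ hF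

/-- An excursion from outside the layers into a layer and back enters and leaves through points
above the same piece. Both lie in the bag at the parent of its root and are at distance at most `s`,
so the excursion is replaced by one `s`-step of the trimmed forest. -/
theorem edist_le_of_chain_true (hB : B.Covered G N ρ) (hrK : r ≤ K) (hrk : 2 * r ≤ k)
    (hs : s = N * (2 * (r + ρ) + r) + 2 * r)
    (hc : ∀ u v, Relation.ReflTransGen
      (fun x y => (B.trim G K k).Linked G s x y ∧ c x = c y) u v → G.edist u v ≤ D) {u v : V}
    (h : Relation.ReflTransGen (fun x y => B.Linked G r x y ∧
      B.extendColouring G K k r c x = true ∧ B.extendColouring G K k r c y = true) u v) :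
    G.edist u v ≤ (2 * (D + s) : ℕ) := by
  set E : V → V → Prop := fun x y => B.Linked G r x y ∧
      B.extendColouring G K k r c x = true ∧ B.extendColouring G K k r c y = true with hE
  set E' : V → V → Prop := fun x y => (B.trim G K k).Linked G s x y ∧ c x = c y with hE'
  set EL : V → V → Prop := fun x y => B.Linked G r x y ∧ B.Layer G K r x ∧ B.Layer G K r y
    with hEL
  have Esymm : ∀ x y, E x y → E y x := fun x y h => ⟨h.1.symm, h.2.2, h.2.1⟩
  have above : ∀ x y, E x y → B.Layer G K r x → ¬ B.Layer G K r y →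
      B.Above G K y (B.piece G K x) := by
    intro x y h hx hy
    have hy' := ((extendColouring_eq_true h.2.2).resolve_left hy).2
    rcases h.1.cases (K := K) with h' | h' | h'
    · exact absurd ((hx.nearRoot.of_edist h'.1 (edist_le_symm h.1.2)).mono (by omega)) hy'.1
    · exact absurd (hx.nearRoot.mono hrK) h'.far
    · exact h'
  -- The invariant: outside the layers the endpoint is reached by `E'`; inside, `y` is the last
  -- point outside, `x₀` the entry point, and the chain has stayed in layers since.
  have key : ∀ w x, ¬ B.Layer G K r w → Relation.ReflTransGen E w x →
      (¬ B.Layer G K r x ∧ Relation.ReflTransGen E' w x) ∨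
      (B.Layer G K r x ∧ ∃ y x₀, Relation.ReflTransGen E' w y ∧ ¬ B.Layer G K r y ∧
        B.extendColouring G K k r c y = true ∧
        B.Layer G K r x₀ ∧ B.Above G K y (B.piece G K x₀) ∧ G.edist y x₀ ≤ r ∧
        Relation.ReflTransGen EL x₀ x) := by
    intro w x hw hwx
    induction hwx with
    | refl => exact Or.inl ⟨hw, .refl⟩
    | @tail x x' h1 h2 ih =>
      by_cases hx' : B.Layer G K r x'
      · refine Or.inr ⟨hx', ?_⟩
        rcases ih with ⟨hx, hwx⟩ | ⟨hx, y, x₀, hwy, hyl, hy, hx₀, hab, hd, hch⟩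
        · exact ⟨x, x', hwx, hx, h2.2.1, hx', above _ _ (Esymm _ _ h2) hx' hx, h2.1.2, .refl⟩
        · exact ⟨y, x₀, hwy, hyl, hy, hx₀, hab, hd, hch.tail ⟨h2.1, hx, hx'⟩⟩
      · refine Or.inl ⟨hx', ?_⟩
        have hx'' := ((extendColouring_eq_true h2.2.2).resolve_left hx').2
        rcases ih with ⟨hx, hwx⟩ | ⟨hx, y, x₀, hwy, hyl, hy, hx₀, hab, hd, hch⟩
        · have hxx := ((extendColouring_eq_true h2.2.1).resolve_left hx).2
          refine hwx.tail ⟨h2.1.trim hx hx' hxx.1 hx''.1 (by omega), ?_⟩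
          rw [hxx.2, hx''.2]
        · have hyy := ((extendColouring_eq_true hy).resolve_left hyl).2
          obtain ⟨hp, hdist⟩ := edist_le_of_chain_layer hB hrK hch hx₀
          have hab' := above _ _ h2 hx hx'
          rw [← hp] at hab'
          refine hwy.tail ⟨⟨⟨B.parent (B.piece G K x₀),
            ⟨hab.mem_parent, hab.anchor_parent, hyy.1⟩,
            ⟨hab'.mem_parent, hab'.anchor_parent, hx''.1⟩⟩, ?_⟩, ?_⟩
          · exact edist_le_mono (edist_le_add (edist_le_add hd hdist) h2.1.2) (by omega)
          · rw [hyy.2, hx''.2]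
  have bound : ∀ w x, ¬ B.Layer G K r w → Relation.ReflTransGen E w x →
      G.edist w x ≤ (D + s : ℕ) := by
    intro w x hw hwx
    rcases key w x hw hwx with ⟨_, h⟩ | ⟨_, y, x₀, hwy, _, _, hx₀, _, hd, hch⟩
    · exact edist_le_mono (hc _ _ h) (by omega)
    · exact edist_le_mono (edist_le_add (edist_le_add (hc _ _ hwy) hd)
        (edist_le_of_chain_layer hB hrK hch hx₀).2) (by omega)
  by_cases hw : ∃ w, Relation.ReflTransGen E u w ∧ ¬ B.Layer G K r w
  · obtain ⟨w, huw, hw⟩ := hw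
    have hwu := huw.swap_of_symm Esymm
    exact edist_le_mono (edist_le_add (edist_le_symm (bound w u hw hwu))
      (bound w v hw (hwu.trans h))) (by omega)
  · push Not at hw
    have hch : Relation.ReflTransGen EL u v := by
      induction h with
      | refl => exact .refl
      | tail h1 h2 ih => exact ih.tail ⟨h2.1, hw _ h1, hw _ (h1.tail h2)⟩
    exact edist_le_mono (edist_le_of_chain_layer hB hrK hch (hw _ .refl)).2 (by omega)

end Extend

/-- Points can be two-coloured such that monochromatic chains of linked points stay bounded, with
a bound depending only on the step size and on how the bags are covered by balls. -/
theorem exists_colouring (N : ℕ) : ∀ r ρ : ℕ, ∃ D : ℕ, ∀ (V T : Type u) (B : BagForest V T)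
    (G : SimpleGraph V), B.Covered G N ρ → ∃ c : V → Bool, ∀ u v,
      Relation.ReflTransGen (fun x y => B.Linked G r x y ∧ c x = c y) u v → G.edist u v ≤ D := by
  induction N with
  -- With no balls all bags are empty, no points are linked and chains are trivial.
  | zero =>
    intro r ρ
    refine ⟨0, fun V T B G hB => ⟨fun _ => true, fun u v h => ?_⟩⟩
    obtain rfl | ⟨w, _, hw⟩ := Relation.ReflTransGen.cases_tail h
    · simp
    · obtain ⟨⟨⟨t, ht, _⟩, _⟩, _⟩ := hw
      obtain ⟨F, hF, hc⟩ := hB t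
      obtain ⟨f, hf, _⟩ := hc _ ht
      rw [Nat.le_zero, Finset.card_eq_zero] at hF
      simp [hF] at hf
  | succ N ih =>
    intro r ρ
    -- The length of a detour through a layer, including the steps in and out; the trimmed forest
    -- has to be coloured for this larger step.
    set s := (N + 1) * (2 * (r + ρ) + r) + 2 * r with hs
    obtain ⟨D, hD⟩ := ih s ρ
    set k := 2 * r + 2 * ρ
    refine ⟨((N + 1) * (2 * (D + r + k + ρ) + r) + D) + 2 * (D + s), fun V T B G hB => ?_⟩
    obtain ⟨c, hc⟩ := hD V T (B.trim G (2 * r) k) G hB.trim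
    refine ⟨B.extendColouring G (2 * r) k r c, fun u v h => ?_⟩
    cases hu : B.extendColouring G (2 * r) k r c u with
    | false =>
      exact edist_le_mono (edist_le_of_chain_false hB (by omega) hc (h.of_colour hu).1)
        (Nat.le_add_right _ _)
    | true =>
      exact edist_le_mono (edist_le_of_chain_true hB (by omega) (by omega) hs hc
        (h.of_colour hu).1) (Nat.le_add_left _ _)

end BagForest

/-! ### Colourings, control functions, and compactness -/

/-- Monochromatic chains with steps at most `R` have endpoints at distance at most `D`. -/
def SimpleGraph.IsChainBounded {V C : Type*} (G : SimpleGraph V) (R D : ℕ) (c : V → C) : Prop :=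
  ∀ u v, Relation.ReflTransGen (fun x y => G.edist x y ≤ R ∧ c x = c y) u v → G.edist u v ≤ D

/-- The intersection graph of an indexed family of sets. -/
def familyGraph {V X : Type*} (S : V → Set X) : SimpleGraph V where
  Adj u v := u ≠ v ∧ (S u ∩ S v).Nonempty
  symm := ⟨fun _ _ h => ⟨h.1.symm, by rw [Set.inter_comm]; exact h.2⟩⟩
  loopless := ⟨fun _ h => h.1 rfl⟩

/-- With `m = ⌈r⌉₊`, take the `m`-neighbourhoods of the monochromatic `2 * m`-components. Distinct
components of one colour are farther than `2 * m` apart, so their neighbourhoods are disjoint, and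
the neighbourhood of the component of `v` contains the `r`-ball at `v`. -/
theorem isControlFunction_of_isChainBounded {V : Type*} (G : SimpleGraph V) {n : ℕ}
    {D : ℕ → ℕ} (h : ∀ R, ∃ c : V → Fin (n + 1), G.IsChainBounded R (D R) c) :
    @IsControlFunction V G.pathEMetricSpace n
      (fun r => ((D (2 * ⌈r⌉₊) + 2 * ⌈r⌉₊ : ℕ) : ℝ≥0)) := by
  let := G.pathEMetricSpace
  intro r _
  set m := ⌈r⌉₊ with hm
  obtain ⟨c, hc⟩ := h (2 * m)
  set E : V → V → Prop := fun x y => G.edist x y ≤ (2 * m : ℕ) ∧ c x = c y with hE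
  have Esymm : ∀ x y, E x y → E y x := fun x y h => ⟨edist_le_symm h.1, h.2.symm⟩
  have hedist : ∀ (x y : V) (k : ℕ), edist x y ≤ (k : ℝ≥0∞) ↔ G.edist x y ≤ k := by
    intro x y k
    rw [← ENat.toENNReal_le, ENat.toENNReal_coe]
    exact Iff.rfl
  have colour_chain : ∀ x y, Relation.ReflTransGen E x y → c x = c y := by
    intro x y h
    exact (h.of_colour rfl).2.symm
  set N : V → Set V := fun v => {y | ∃ x, Relation.ReflTransGen E v x ∧ G.edist y x ≤ m} with hN
  have hmem : ∀ v, N v ∈ ⋃ i, {U | ∃ w, c w = i ∧ U = N w} := fun v =>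
    Set.mem_iUnion.2 ⟨c v, v, rfl, rfl⟩
  refine ⟨fun i => {U | ∃ w, c w = i ∧ U = N w}, ?_, ?_, ?_, ?_⟩
  · refine Set.eq_univ_of_forall fun v => Set.mem_sUnion.2 ⟨N v, hmem v, v, .refl, by simp⟩
  · rintro i _ ⟨v, rfl, rfl⟩ _ ⟨w, hw, rfl⟩ hne
    refine Set.disjoint_left.2 fun y hyv hyw => hne ?_
    obtain ⟨x, hvx, hyx⟩ := hyv
    obtain ⟨z, hwz, hyz⟩ := hyw
    have hxz : E x z := ⟨edist_le_mono (edist_le_add (edist_le_symm hyx) hyz) (by omega),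
      by rw [← colour_chain _ _ hvx, ← colour_chain _ _ hwz, hw]⟩
    have hvw := (hvx.tail hxz).trans (hwz.swap_of_symm Esymm)
    ext y
    exact ⟨fun ⟨a, ha, hy⟩ => ⟨a, (hvw.swap_of_symm Esymm).trans ha, hy⟩,
      fun ⟨a, ha, hy⟩ => ⟨a, hvw.trans ha, hy⟩⟩
  · refine iSup₂_le fun U hU => ?_
    obtain ⟨i, v, rfl, rfl⟩ := Set.mem_iUnion.1 hU
    refine Metric.ediam_le ?_
    rintro x ⟨x', hvx, hx⟩ y ⟨y', hvy, hy⟩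
    have := edist_le_add (edist_le_add hx (hc _ _ ((hvx.swap_of_symm Esymm).trans hvy)))
      (edist_le_symm hy)
    rw [ENNReal.coe_natCast, hedist]
    exact edist_le_mono this (le_of_eq (by rw [← hm]; ring))
  · refine le_iSup₂_of_le r (fun v => ⟨N v, hmem v, fun y hy => ⟨v, .refl, ?_⟩⟩) le_rfl
    rw [← hedist]
    refine (Metric.mem_closedEBall.1 hy).trans ?_
    exact_mod_cast Nat.le_ceil r

theorem SimpleGraph.exists_walk_of_edist_le {V : Type*} {G : SimpleGraph V} {u v : V} {k : ℕ}
    (h : G.edist u v ≤ k) : ∃ p : G.Walk u v, p.length ≤ k := by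
  obtain ⟨p, hp⟩ := G.exists_walk_of_edist_ne_top (ne_top_of_le_ne_top (ENat.natCast_ne_top k) h)
  exact ⟨p, by exact_mod_cast hp.trans_le h⟩

open Filter in
/-- A compactness principle: bounded colourings of the finite subsystems give one of the system. -/
theorem exists_isChainBounded_of_finset {V X C : Type*} [Finite C] (S : V → Set X) (R D : ℕ)
    (h : ∀ A : Finset V, ∃ c : V → C,
      (familyGraph fun v => {x | x ∈ S v ∧ v ∈ A}).IsChainBounded R D c) :
    ∃ c : V → C, (familyGraph S).IsChainBounded R D c := by
  classical
  choose c hc using h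
  let 𝒰 : Ultrafilter (Finset V) := Ultrafilter.of atTop
  have hlim : ∀ v, ∃ i, ∀ᶠ A in (𝒰 : Filter (Finset V)), c A v = i := fun v =>
    Ultrafilter.eventually_exists_iff.1 (Eventually.of_forall fun A => ⟨c A v, rfl⟩)
  choose c' hc' using hlim
  set G : Finset V → SimpleGraph V := fun A => familyGraph fun v => {x | x ∈ S v ∧ v ∈ A}
  have hle : ∀ A, G A ≤ familyGraph S := fun A u v h =>
    ⟨h.1, h.2.imp fun x hx => ⟨hx.1.1, hx.2.1⟩⟩
  -- A walk uses finitely many vertices, so it survives in all sufficiently large finite subsystems.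
  have hdist : ∀ x y, (familyGraph S).edist x y ≤ R →
      ∀ᶠ A in (𝒰 : Filter (Finset V)), (G A).edist x y ≤ R := by
    intro x y hxy
    obtain ⟨p, hp⟩ := SimpleGraph.exists_walk_of_edist_le hxy
    refine (Ultrafilter.of_le _) ((eventually_ge_atTop p.support.toFinset).mono fun A hA => ?_)
    have hedge : ∀ e ∈ p.edges, e ∈ (G A).edgeSet := by
      intro e he
      induction e with | _ a b
      have ha : a ∈ A := hA (List.mem_toFinset.2 (p.fst_mem_support_of_mem_edges he))
      have hb : b ∈ A := hA (List.mem_toFinset.2 (p.snd_mem_support_of_mem_edges he))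
      obtain ⟨hne, z, hz⟩ := p.adj_of_mem_edges he
      exact ⟨hne, z, ⟨hz.1, ha⟩, ⟨hz.2, hb⟩⟩
    refine (p.transfer (G A) hedge).edist_le.trans ?_
    rw [SimpleGraph.Walk.length_transfer]
    exact_mod_cast hp
  refine ⟨c', fun u v huv => ?_⟩
  have hev : ∀ᶠ A in (𝒰 : Filter (Finset V)),
      Relation.ReflTransGen (fun x y => (G A).edist x y ≤ R ∧ c A x = c A y) u v := by
    induction huv with
    | refl => exact Eventually.of_forall fun A => .refl
    | @tail y z _ hyz ih =>
      filter_upwards [ih, hdist y z hyz.1, hc' y, hc' z] with A h1 h2 h3 h4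
      exact h1.tail ⟨h2, by rw [h3, h4, hyz.2]⟩
  obtain ⟨A, hA⟩ := hev.exists
  exact (SimpleGraph.edist_anti (hle A)).trans (hc A u v hA)

/-! ### Coloured coverings at geometric scales -/

section Scales

variable {X : Type*} [MetricSpace X]

/-- A linear control function colours the space at every scale so that close points of the same
colour share a label, while points sharing a label are not too far apart. -/
theorem exists_labelling {n : ℕ} {K : ℝ≥0}
    (hK : IsControlFunction X n fun r => K * r) {ρ : ℝ} (hρ : 0 < ρ) :
    ∃ (col : X → Fin (n + 1)) (M : X → Set X),
      (∀ x y, col x = col y → dist x y ≤ ρ → M x = M y) ∧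
      ∀ x y, M x = M y → dist x y ≤ 2 * K * ρ := by
  lift ρ to ℝ≥0 using hρ.le
  have hρ' : 0 < ρ := by exact_mod_cast hρ
  -- The Lebesgue number is a supremum; asking for `2 * ρ` yields an attained radius above `ρ`.
  obtain ⟨𝓤, -, hdisj, hmesh, hleb⟩ := hK (2 * ρ) (by positivity)
  have hlt : (ρ : ℝ≥0∞) < lebesgueNumberOf (⋃ i, 𝓤 i) :=
    lt_of_lt_of_le (by exact_mod_cast lt_two_mul_self hρ') hleb
  obtain ⟨r, hr⟩ := lt_iSup_iff.1 hlt
  obtain ⟨hball, hr⟩ := lt_iSup_iff.1 hr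
  choose M hM hsub using hball
  choose col hcol using fun x => Set.mem_iUnion.1 (hM x)
  have hself : ∀ x, x ∈ M x := fun x => hsub x (by simp)
  refine ⟨col, M, fun x y hxy hd => ?_, fun x y hxy => ?_⟩
  · by_contra hne
    refine Set.disjoint_left.1 (hdisj (col x) (hcol x) (hxy ▸ hcol y) hne) (hsub x ?_) (hself y)
    rw [Metric.mem_closedEBall, edist_comm]
    refine le_trans ?_ hr.le
    rw [edist_nndist]
    exact_mod_cast hd
  · have h1 : edist x y ≤ ((K * (2 * ρ) : ℝ≥0) : ℝ≥0∞) := by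
      refine (Metric.edist_le_ediam_of_mem (hself x) (hxy ▸ hself y)).trans ?_
      exact (le_iSup₂ (f := fun U (_ : U ∈ ⋃ i, 𝓤 i) => Metric.ediam U) (M x) (hM x)).trans hmesh
    rw [edist_nndist] at h1
    have h2 : nndist x y ≤ K * (2 * ρ) := by exact_mod_cast h1
    have h3 : dist x y ≤ K * (2 * ρ) := by exact_mod_cast h2
    linarith

/-- Points of the same colour whose balls, at the scales of the points, may meet. -/
def CloseAtScales {V C : Type*} (a σ : ℝ) (k : V → ℕ) (p : V → X) (i : V → C) (u v : V) : Prop :=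
  i u = i v ∧ dist (p u) (p v) ≤ a * σ ^ k u + a * σ ^ k v

/-- Chains of points at scales below `j` stay small compared with the scale `j`. -/
theorem dist_le_of_chain_closeAtScales {V C : Type*} {a σ L : ℝ} (ha : 0 < a) (hL : 0 ≤ L)
    (hσ : 6 + 5 * L ≤ σ) {k : V → ℕ} {p : V → X} {col : ℕ → X → C} {M : ℕ → X → Set X}
    (h1 : ∀ j x y, col j x = col j y → dist x y ≤ 5 * (a * σ ^ j) → M j x = M j y)
    (h2 : ∀ j x y, M j x = M j y → dist x y ≤ L * (5 * (a * σ ^ j))) (j : ℕ) {u v : V}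
    (h : Relation.ReflTransGen (fun x y => CloseAtScales a σ k p (fun v => col (k v) (p v)) x y ∧
      k x < j ∧ k y < j) u v) : dist (p u) (p v) ≤ a * σ ^ j := by
  have hσ1 : 1 ≤ σ := by linarith
  induction j generalizing u v with
  | zero =>
    obtain rfl | ⟨w, _, hw⟩ := Relation.ReflTransGen.cases_tail h
    · simp [ha.le]
    · omega
  | succ j ih =>
    set i : V → C := fun v => col (k v) (p v) with hi
    set A := a * σ ^ j with hA
    have hApos : 0 < A := by positivity
    have hscale : ∀ x, k x < j + 1 → a * σ ^ k x ≤ A := fun x hx =>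
      mul_le_mul_of_nonneg_left (pow_le_pow_right₀ hσ1 (by omega)) ha.le
    have hnear : ∀ x y, CloseAtScales a σ k p i x y → k x < j + 1 → k y < j + 1 →
        dist (p x) (p y) ≤ 2 * A := fun x y h hx hy => by
      linarith [h.2, hscale x hx, hscale y hy]
    have hM : ∀ x y, k x = j → k y = j → i x = i y → dist (p x) (p y) ≤ 5 * A →
        M j (p x) = M j (p y) := by
      intro x y hx hy hxy hd
      refine h1 j _ _ ?_ hd
      simp only [hi, hx, hy] at hxy
      exact hxy
    set R : V → V → Prop := fun x y => CloseAtScales a σ k p i x y ∧ k x < j ∧ k y < j with hR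
    have hgoal : A ≤ a * σ ^ (j + 1) ∧ (6 + 5 * L) * A ≤ a * σ ^ (j + 1) := by
      have : a * σ ^ (j + 1) = σ * A := by rw [hA]; ring
      rw [this]
      constructor <;> nlinarith
    obtain rfl | ⟨w, hw, -⟩ := Relation.ReflTransGen.cases_head h
    · rw [dist_self]; linarith [hgoal.1]
    have hu := hw.2.1
    clear hw
    -- Between consecutive visits to scale `j` the chain makes two steps of at most `2 * A` and a
    -- lower run of at most `A`. Hence these visits are at most `5 * A` apart and all share the
    -- label of the first one, `t₁`. The pieces before the first and after the last visit cost `3 *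
    -- A` each and the common label `5 * L * A`, whence `6 + 5 * L`.
    have state : (k v < j ∧ Relation.ReflTransGen R u v) ∨
        ∃ t₁ t₂, k t₂ = j ∧ M j (p t₁) = M j (p t₂) ∧ dist (p u) (p t₁) ≤ 3 * A ∧
          i v = i t₂ ∧ (v = t₂ ∨ k v < j ∧ ∃ y, k y < j ∧ CloseAtScales a σ k p i t₂ y ∧
            Relation.ReflTransGen R y v) := by
      induction h with
      | refl =>
        rcases Nat.lt_succ_iff_lt_or_eq.1 hu with hu | hu
        · exact Or.inl ⟨hu, .refl⟩
        · exact Or.inr ⟨u, u, hu, rfl, by simp [hApos.le], rfl, Or.inl rfl⟩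
      | @tail v v' _ hvv ihs =>
        obtain ⟨hc, hv, hv'⟩ := hvv
        have hd := hnear v v' hc hv hv'
        rcases ihs with ⟨hvj, hrun⟩ | ⟨t₁, t₂, ht, hMt, hdt, hiv, hlast⟩
        · rcases Nat.lt_succ_iff_lt_or_eq.1 hv' with hv' | hv'
          · exact Or.inl ⟨hv', hrun.tail ⟨hc, hvj, hv'⟩⟩
          · refine Or.inr ⟨v', v', hv', rfl, ?_, rfl, Or.inl rfl⟩
            linarith [dist_triangle (p u) (p v) (p v'), ih hrun]
        · refine Or.inr ?_
          have hiv' : i v' = i t₂ := hc.1.symm.trans hiv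
          rcases hlast with rfl | ⟨hvj, y, hy, hty, hrun⟩
          · rcases Nat.lt_succ_iff_lt_or_eq.1 hv' with hv' | hv'
            · exact ⟨t₁, v, ht, hMt, hdt, hiv', Or.inr ⟨hv', v', hv', hc, .refl⟩⟩
            · exact ⟨t₁, v', hv', hMt.trans (hM _ _ ht hv' hiv'.symm (by linarith)), hdt, rfl,
                Or.inl rfl⟩
          · rcases Nat.lt_succ_iff_lt_or_eq.1 hv' with hv' | hv'
            · exact ⟨t₁, t₂, ht, hMt, hdt, hiv',
                Or.inr ⟨hv', y, hy, hty, hrun.tail ⟨hc, hvj, hv'⟩⟩⟩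
            · refine ⟨t₁, v', hv', hMt.trans (hM _ _ ht hv' hiv'.symm ?_), hdt, rfl, Or.inl rfl⟩
              linarith [dist_triangle4 (p t₂) (p y) (p v) (p v'), ih hrun,
                hnear t₂ y hty (by omega) (by omega)]
    rcases state with ⟨_, hrun⟩ | ⟨t₁, t₂, ht, hMt, hdt, -, hlast⟩
    · exact (ih hrun).trans hgoal.1
    · have h12 := h2 j _ _ hMt
      have hlast' : dist (p t₂) (p v) ≤ 3 * A := by
        rcases hlast with rfl | ⟨_, y, hy, hty, hrun⟩
        · simp [hApos.le]
        · linarith [dist_triangle (p t₂) (p y) (p v), ih hrun,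
            hnear t₂ y hty (by omega) (by omega)]
      refine le_trans ?_ hgoal.2
      linarith [dist_triangle4 (p u) (p t₁) (p t₂) (p v)]

end Scales

/-! ### Packing round sets in doubling spaces -/

section Packing

variable {X : Type*} [MetricSpace X]

theorem exists_cover_of_doubling {K : ℕ} (hK : ∀ r : ℝ, 0 < r → ∀ x : X, ∃ t : Finset X,
    t.card ≤ K ∧ Metric.closedBall x r ⊆ ⋃ c ∈ t, Metric.closedBall c (r / 2)) (m : ℕ) :
    ∀ r : ℝ, 0 < r → ∀ x : X, ∃ t : Finset X,
      t.card ≤ K ^ m ∧ Metric.closedBall x r ⊆ ⋃ c ∈ t, Metric.closedBall c (r / 2 ^ m) := by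
  classical
  induction m with
  | zero => exact fun r _ x => ⟨{x}, by simp, by simp⟩
  | succ m ih =>
    intro r hr x
    obtain ⟨t, ht, hsub⟩ := ih r hr x
    choose f hf hfs using hK (r / 2 ^ m) (by positivity)
    refine ⟨t.biUnion f, ?_, fun y hy => ?_⟩
    · refine (Finset.card_biUnion_le_card_mul t f K fun c _ => hf c).trans ?_
      rw [pow_succ]
      exact Nat.mul_le_mul_right _ ht
    · obtain ⟨c, hc, hyc⟩ := Set.mem_iUnion₂.1 (hsub hy)
      obtain ⟨d, hd, hyd⟩ := Set.mem_iUnion₂.1 (hfs c hyc)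
      refine Set.mem_iUnion₂.2 ⟨d, Finset.mem_biUnion.2 ⟨c, hc, hd⟩, ?_⟩
      rwa [pow_succ, ← div_div]

/-- In a doubling space, separated sets in a ball have bounded cardinality. -/
theorem exists_card_bound_of_doubling (hX : IsDoublingSpace X) {β : ℝ} (hβ : 0 < β) (R : ℝ) :
    ∃ N : ℕ, ∀ θ : ℝ, 0 < θ → ∀ (x : X) {ι : Type u} (F : Finset ι) (z : ι → X),
      (∀ i ∈ F, dist (z i) x ≤ R * θ) →
      (∀ i ∈ F, ∀ j ∈ F, i ≠ j → β * θ < dist (z i) (z j)) → F.card ≤ N := by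
  classical
  obtain ⟨K, hK⟩ := hX
  -- Doubling needs a positive radius, and `R` is arbitrary.
  set R' := max R 1
  -- After `m` halvings the covering balls are too small to contain two separated points.
  obtain ⟨m, hm⟩ := pow_unbounded_of_one_lt (2 * R' / β) one_lt_two
  refine ⟨K ^ m, fun θ hθ x ι F z hz hsep => ?_⟩
  obtain ⟨t, ht, hsub⟩ := exists_cover_of_doubling hK m (R' * θ) (by positivity) x
  have hsmall : 2 * (R' * θ / 2 ^ m) ≤ β * θ := by
    rw [div_lt_iff₀ hβ] at hm
    rw [← mul_div_assoc, div_le_iff₀ (by positivity)]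
    nlinarith
  have hc : ∀ i, i ∈ F → ∃ c ∈ t, dist (z i) c ≤ R' * θ / 2 ^ m := by
    intro i hi
    have : z i ∈ Metric.closedBall x (R' * θ) :=
      (hz i hi).trans (mul_le_mul_of_nonneg_right (le_max_left _ _) hθ.le)
    simpa using hsub this
  have : Nonempty X := ⟨x⟩
  choose! c hct hcd using hc
  refine (Finset.card_le_card_of_injOn c hct fun i hi j hj hij => ?_).trans ht
  by_contra hne
  have h1 := hcd i hi
  have h2 := hcd j hj
  rw [← hij, dist_comm] at h2
  linarith [hsep i hi j hj hne, dist_triangle (z i) (c i) (z j)]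

/-- In a doubling space, there are boundedly many disjoint large round sets near a given point. -/
theorem exists_packing_bound (hX : IsDoublingSpace X) {η : ℝ} (hη : 0 < η) (R : ℝ) :
    ∃ N : ℕ, ∀ θ : ℝ, 0 < θ → ∀ (x : X) {V : Type u} (S : V → Set X) (F : Finset V),
      (∀ v ∈ F, IsRound η (S v) ∧ θ ≤ Metric.diam (S v) ∧ ∃ q ∈ S v, dist q x ≤ R * θ) →
      (∀ v ∈ F, ∀ w ∈ F, v ≠ w → Disjoint (S v) (S w)) → F.card ≤ N := by
  obtain ⟨N, hN⟩ := exists_card_bound_of_doubling.{u} hX hη (R + 1)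
  refine ⟨N, fun θ hθ x V S F hF hdisj => ?_⟩
  -- Roundness at scale `θ` rather than at the full diameter gives a ball of radius `η * θ` inside
  -- the set and still near `x`; disjointness separates the centres.
  have hz : ∀ v, v ∈ F → ∃ z ∈ S v, dist z x ≤ (R + 1) * θ ∧
      Metric.closedBall z (η * θ) ⊆ S v := by
    intro v hv
    obtain ⟨hr, hd, q, hq, hqx⟩ := hF v hv
    obtain ⟨z, hz, hsub⟩ := hr.2 q hq θ hθ.le hd
    refine ⟨z, hz, ?_, fun y hy => (hsub hy).1⟩
    have hzq : dist z q ≤ θ := (hsub (Metric.mem_closedBall_self (by positivity))).2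
    linarith [dist_triangle z q x]
  have : Nonempty X := ⟨x⟩
  choose! z hzS hzx hzb using hz
  refine hN θ hθ x F z hzx fun v hv w hw hne => ?_
  by_contra! hle
  refine Set.disjoint_left.1 (hdisj v hv w hw hne) (hzb v hv ?_) (hzS w hw)
  rwa [Metric.mem_closedBall, dist_comm]

end Packing

/-! ### Walks in intersection graphs -/

section Walks

variable {X V : Type*} [MetricSpace X] {S : V → Set X}

/-- Stop at the first set of diameter at least `θ`: all earlier ones are smaller, so each moves the
position by at most `θ`. The end `y` itself need not be near `q` at scale `θ`, since the walk may
cross huge sets. -/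
theorem exists_large_on_walk (hb : ∀ v, Bornology.IsBounded (S v)) {θ : ℝ} (hθ : 0 ≤ θ) {x y : V}
    (w : (familyGraph S).Walk x y) (hy : θ ≤ Metric.diam (S y)) {q : X} (hq : q ∈ S x) :
    ∃ z, (familyGraph S).edist x z ≤ w.length ∧ θ ≤ Metric.diam (S z) ∧
      ∃ q' ∈ S z, dist q' q ≤ w.length * θ := by
  induction w generalizing q with
  | nil => exact ⟨_, by simp, hy, q, hq, by simp⟩
  | @cons x x' y h p ih =>
    by_cases hx : θ ≤ Metric.diam (S x)
    · exact ⟨x, by simp, hx, q, hq, by rw [dist_self]; positivity⟩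
    · obtain ⟨q₁, hq₁, hq₁'⟩ := h.2
      obtain ⟨z, hz, hzd, q', hq', hqq⟩ := ih hy hq₁'
      refine ⟨z, ?_, hzd, q', hq', ?_⟩
      · rw [SimpleGraph.Walk.length_cons, add_comm]
        exact edist_le_add (SimpleGraph.edist_le_one_iff_adj_or_eq.2 (Or.inl h)) hz
      · rw [SimpleGraph.Walk.length_cons]
        push_cast
        have := Metric.dist_le_diam_of_mem (hb x) hq₁ hq
        linarith [dist_triangle q' q₁ q]

theorem dist_le_of_walk (hb : ∀ v, Bornology.IsBounded (S v)) {θ : ℝ} {x y : V}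
    (w : (familyGraph S).Walk x y) (hw : ∀ z ∈ w.support, Metric.diam (S z) ≤ θ) {q q' : X}
    (hq : q ∈ S x) (hq' : q' ∈ S y) : dist q q' ≤ (w.length + 1) * θ := by
  induction w generalizing q with
  | nil => simpa using (Metric.dist_le_diam_of_mem (hb _) hq hq').trans (hw _ (by simp))
  | @cons x x' y h p ih =>
    obtain ⟨q₁, hq₁, hq₁'⟩ := h.2
    have h1 := ih (fun z hz => hw z (by simp [hz])) hq₁' hq'
    have h2 := (Metric.dist_le_diam_of_mem (hb x) hq hq₁).trans (hw x (by simp))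
    rw [SimpleGraph.Walk.length_cons]
    push_cast
    linarith [dist_triangle q q₁ q']

theorem edist_le_of_mem_support {G : SimpleGraph V} {x y z : V} (w : G.Walk x y)
    (hz : z ∈ w.support) : G.edist x z ≤ w.length := by
  classical
  exact (w.takeUntil z hz).edist_le.trans (by exact_mod_cast w.length_takeUntil_le_length hz)

/-- Sets at distance at most `r` that are connected through sets of diameter at most `θ`. -/
theorem dist_le_of_edist_le (hb : ∀ v, Bornology.IsBounded (S v)) {θ : ℝ} {r : ℕ} {x y : V}
    (hxy : (familyGraph S).edist x y ≤ r)
    (h : ∀ z, (familyGraph S).edist x z ≤ r → Metric.diam (S z) ≤ θ) {q q' : X}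
    (hq : q ∈ S x) (hq' : q' ∈ S y) : dist q q' ≤ (r + 1) * θ := by
  obtain ⟨w, hw⟩ := SimpleGraph.exists_walk_of_edist_le hxy
  have hθ : 0 ≤ θ := Metric.diam_nonneg.trans (h x (by simp))
  refine (dist_le_of_walk hb w (fun z hz => h z ?_) hq hq').trans ?_
  · exact (edist_le_of_mem_support w hz).trans (by exact_mod_cast hw)
  · gcongr

theorem exists_largest_within (hfin : (Set.range fun v => Metric.diam (S v)).Finite) (r : ℕ)
    (v : V) : ∃ m, (familyGraph S).edist v m ≤ r ∧
      ∀ u, (familyGraph S).edist v u ≤ r → Metric.diam (S u) ≤ Metric.diam (S m) := by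
  have hsub : ((fun v => Metric.diam (S v)) '' {u | (familyGraph S).edist v u ≤ r}).Finite :=
    hfin.subset (Set.image_subset_range _ _)
  obtain ⟨_, ⟨m, hm, rfl⟩, hmax⟩ := Set.exists_max_image _ id hsub ⟨_, v, by simp, rfl⟩
  exact ⟨m, hm, fun u hu => hmax _ ⟨u, hu, rfl⟩⟩

/-- A set all of whose nearby sets have diameter zero is isolated. -/
theorem eq_of_edist_le_of_diam (hb : ∀ v, Bornology.IsBounded (S v))
    (hinj : ∀ u v, (S u).Nonempty → S u = S v → u = v) {r : ℕ} {x y : V}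
    (hxy : (familyGraph S).edist x y ≤ r)
    (h : ∀ z, (familyGraph S).edist x z ≤ r → Metric.diam (S z) ≤ 0) : x = y := by
  obtain ⟨w, hw⟩ := SimpleGraph.exists_walk_of_edist_le hxy
  cases w with
  | nil => rfl
  | @cons _ z _ hz p =>
    exfalso
    have hr : 1 ≤ r := by rw [SimpleGraph.Walk.length_cons] at hw; omega
    have hxz : (familyGraph S).edist x z ≤ r :=
      edist_le_mono (SimpleGraph.edist_le_one_iff_adj_or_eq.2 (Or.inl hz)) hr
    obtain ⟨q, hqx, hqz⟩ := hz.2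
    have key : ∀ u, (familyGraph S).edist x u ≤ r → q ∈ S u → S u = {q} := by
      intro u hu hq
      refine Set.eq_singleton_iff_unique_mem.2 ⟨hq, fun q' hq' => dist_le_zero.1 ?_⟩
      exact (Metric.dist_le_diam_of_mem (hb u) hq' hq).trans (h u hu)
    exact hz.1 (hinj x z ⟨q, hqx⟩ ((key x (by simp) hqx).trans (key z hxz hqz).symm))

end Walks

/-- A maximal disjoint subfamily dominates the family in the intersection graph. -/
theorem exists_dominating_finset {X V : Type*} {S : V → Set X} {N : ℕ} {W : Set V} (hN : ∀ F : Finset V, (∀ v ∈ F, v ∈ W) →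
      (∀ v ∈ F, ∀ w ∈ F, v ≠ w → Disjoint (S v) (S w)) → F.card ≤ N) :
    ∃ F : Finset V, F.card ≤ N ∧ ∀ w ∈ W, ∃ f ∈ F, (familyGraph S).edist w f ≤ 1 := by
  classical
  let P : ℕ → Prop := fun n => ∃ F : Finset V, (∀ v ∈ F, v ∈ W) ∧
    (∀ v ∈ F, ∀ w ∈ F, v ≠ w → Disjoint (S v) (S w)) ∧ F.card = n
  have h0 : P 0 := ⟨∅, by simp, by simp, rfl⟩
  obtain ⟨F, hFW, hFd, hF⟩ := Nat.findGreatest_spec (P := P) (Nat.zero_le N) h0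
  refine ⟨F, hN F hFW hFd, fun w hw => ?_⟩
  by_contra! hcon
  have hwF : w ∉ F := fun h => by simpa using hcon w h
  have hdisj : ∀ f ∈ F, Disjoint (S w) (S f) := by
    intro f hf
    by_contra hd
    refine absurd (hcon f hf) (not_lt.2 (SimpleGraph.edist_le_one_iff_adj_or_eq.2 (Or.inl ⟨?_, ?_⟩)))
    · rintro rfl; exact hwF hf
    · exact Set.not_disjoint_iff_nonempty_inter.1 hd
  have hins : P (F.card + 1) := by
    refine ⟨insert w F, ?_, ?_, Finset.card_insert_of_notMem hwF⟩
    · intro v hv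
      rcases Finset.mem_insert.1 hv with rfl | hv
      exacts [hw, hFW v hv]
    · intro v hv v' hv' hne
      rcases Finset.mem_insert.1 hv with h | h <;> rcases Finset.mem_insert.1 hv' with h' | h'
      · exact absurd (h.trans h'.symm) hne
      · exact h ▸ hdisj v' h'
      · exact h' ▸ (hdisj v h).symm
      · exact hFd v h v' h' hne
  obtain ⟨F', h1, h2, h3⟩ := id hins
  have hle := Nat.le_findGreatest (P := P) (h3 ▸ hN F' h1 h2) hins
  omega

/-! ### The forest of clusters of a multi-scale family -/

section Forest

variable {V : Type u}

/-- The cluster of `v` at scale `j`: the points reached by chains of points at scales up to `j`. -/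
def scaleCluster (k : V → ℕ) (E : V → V → Prop) (j : ℕ) (v : V) : Set V :=
  {u | Relation.ReflTransGen (fun x y => E x y ∧ k x < j + 1 ∧ k y < j + 1) v u}

theorem scaleCluster_eq_of_mem {k : V → ℕ} {E : V → V → Prop} (hE : ∀ x y, E x y → E y x) {j : ℕ}
    {u v : V} (h : u ∈ scaleCluster k E j v) : scaleCluster k E j v = scaleCluster k E j u := by
  have h' : Relation.ReflTransGen (fun x y => E x y ∧ k x < j + 1 ∧ k y < j + 1) u v :=
    Relation.ReflTransGen.swap_of_symm (fun x y h => ⟨hE _ _ h.1, h.2.2, h.2.1⟩) h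
  ext w
  exact ⟨fun hw => h'.trans hw, fun hw => Relation.ReflTransGen.trans h hw⟩

/-- A node of the forest stores a cluster without a base point, so its parent is defined as a union
over the cluster; it is again a cluster. -/
theorem scaleCluster_succ {k : V → ℕ} {E : V → V → Prop} {j : ℕ} {v : V} :
    {u | ∃ x ∈ scaleCluster k E j v, u ∈ scaleCluster k E (j + 1) x} =
      scaleCluster k E (j + 1) v := by
  ext u
  constructor
  · rintro ⟨x, hx, hu⟩
    have hmono : (fun x y => E x y ∧ k x < j + 1 ∧ k y < j + 1) ≤
        fun x y => E x y ∧ k x < j + 1 + 1 ∧ k y < j + 1 + 1 :=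
      fun a b h => ⟨h.1, by omega, by omega⟩
    exact Relation.ReflTransGen.trans (Relation.ReflTransGen.mono hmono v x hx) hu
  · exact fun hu => ⟨v, .refl, hu⟩

open Classical in
/-- The forest of clusters, where `v` stays in the bags of its clusters from its own scale on for
as long as `P v` holds. -/
noncomputable def scaleForest (k : V → ℕ) (E : V → V → Prop) (P : V → ℕ → Prop) (m : ℕ)
    (hm : ∀ v j, P v j → j ≤ m) (hP : ∀ v i j, i ≤ j → P v j → P v i) :
    BagForest V (ℕ × Set V) where
  parent t := (t.1 + 1, {u | ∃ x ∈ t.2, u ∈ scaleCluster k E (t.1 + 1) x})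
  -- Parents are coarser clusters, so levels count down from the top scale `m`; by truncation all
  -- scales from `m` on are roots.
  level t := m - t.1
  bag t := {v | t.2 = scaleCluster k E t.1 v ∧ k v ≤ t.1 ∧ P v t.1}
  top v := (Nat.findGreatest (P v) m, scaleCluster k E (Nat.findGreatest (P v) m) v)
  level_parent t ht := by simp only; omega
  mem_parent := by
    rintro v ⟨j, A⟩ ⟨hA, hk, hPj⟩ hne
    simp only at hA hk hPj ⊢
    subst hA
    have hjm := hm v j hPj
    have hle := Nat.le_findGreatest hjm hPj
    have hlt : j < Nat.findGreatest (P v) m := by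
      refine lt_of_le_of_ne hle fun h => hne ?_
      rw [← h]
    have hPt := Nat.findGreatest_spec hjm hPj
    have hmt := hm v _ hPt
    exact ⟨by omega, scaleCluster_succ, hk.trans (Nat.le_succ j), hP v _ _ hlt hPt⟩

end Forest

/-! ### Colouring systems of round sets with finitely many diameters -/

section RoundSystems

variable {X : Type u} [MetricSpace X] {V : Type u} {S : V → Set X}

theorem exists_pos_le_diam (hfin : (Set.range fun v => Metric.diam (S v)).Finite) :
    ∃ s₀ : ℝ, 0 < s₀ ∧ ∀ v, 0 < Metric.diam (S v) → s₀ ≤ Metric.diam (S v) := by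
  by_cases h : ∃ v, 0 < Metric.diam (S v)
  · obtain ⟨v, hv⟩ := h
    have hsub : {x | x ∈ Set.range (fun v => Metric.diam (S v)) ∧ 0 < x}.Finite :=
      hfin.subset fun x hx => hx.1
    obtain ⟨s, hs, hmin⟩ := Set.exists_min_image _ id hsub ⟨_, ⟨v, rfl⟩, hv⟩
    exact ⟨s, hs.2, fun w hw => hmin _ ⟨⟨w, rfl⟩, hw⟩⟩
  · push Not at h
    exact ⟨1, one_pos, fun v hv => absurd (h v) (not_le.2 hv)⟩

theorem exists_diam_lt_pow (hfin : (Set.range fun v => Metric.diam (S v)).Finite) {s₀ σ : ℝ}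
    (hs : 0 < s₀) (hσ : 1 < σ) : ∃ m : ℕ, ∀ v, Metric.diam (S v) < s₀ * σ ^ m := by
  obtain ⟨B, hB⟩ := hfin.bddAbove
  obtain ⟨m, hm⟩ := pow_unbounded_of_one_lt (B / s₀) hσ
  refine ⟨m, fun v => (hB ⟨v, rfl⟩).trans_lt ?_⟩
  rwa [div_lt_iff₀' hs] at hm

/-- The main construction. Injectivity is demanded only for nonempty sets because the reduction to
finite subsystems empties many members. -/
theorem exists_isChainBounded_of_finite_range (hX : IsDoublingSpace X) {η : ℝ} (hη : 0 < η) {n : ℕ}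
    {K : ℝ≥0} (hK : IsControlFunction X n fun r => K * r) (r : ℕ) :
    ∃ D : ℕ, ∀ (V : Type u) (S : V → Set X), (∀ v, IsRound η (S v)) →
      (∀ u v, (S u).Nonempty → S u = S v → u = v) →
      (Set.range fun v => Metric.diam (S v)).Finite →
      ∃ c : V → Fin (n + 1) × Bool, (familyGraph S).IsChainBounded r D c := by
  classical
  set L : ℝ := 2 * K with hL
  have hL0 : 0 ≤ L := by positivity
  set σ : ℝ := 6 + 5 * L with hσ
  have hσ1 : 1 < σ := by linarith
  have hσ0 : 0 < σ := by linarith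
  -- A large set is found on a walk of length `3 * r` starting at `m v`, and positions within a
  -- cluster differ by at most `(2 * r + 1) * σ * σ` times the scale. In the covering radius `4 * r
  -- + 1` below, `r` leads to `m v`, `3 * r` to the large set, and `1` to the dominating family.
  obtain ⟨N, hN⟩ := exists_packing_bound.{u} hX hη ((3 * r : ℕ) + (2 * r + 1) * σ * σ)
  obtain ⟨D, hD⟩ := BagForest.exists_colouring.{u} N r (4 * r + 1)
  refine ⟨D, fun V S hS hinj hfin => ?_⟩
  set G := familyGraph S with hG
  have hb : ∀ v, Bornology.IsBounded (S v) := fun v => (hS v).1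
  choose m hmd hmax using exists_largest_within (S := S) hfin r
  set pos : V → Prop := fun v => 0 < Metric.diam (S (m v)) with hpos
  -- Vertices that see only diameter zero within distance `r` have no other vertex there, so their
  -- colours are irrelevant.
  have isolated : ∀ v u, ¬ pos v → G.edist v u ≤ r → v = u := fun v u hv hvu =>
    eq_of_edist_le_of_diam hb hinj hvu fun z hz => (hmax v z hz).trans (not_lt.1 hv)
  by_cases hex : ∃ v, pos v
  swap
  · push Not at hex
    refine ⟨fun _ => (0, true), fun u v huv => ?_⟩
    have : u = v := by
      induction huv with
      | refl => rfl
      | tail _ h ih => exact ih.trans (isolated _ _ (hex _) h.1)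
    simp [this]
  have nonempty_of_pos : ∀ v, 0 < Metric.diam (S v) → (S v).Nonempty := by
    intro v hv
    by_contra hne
    rw [Set.not_nonempty_iff_eq_empty] at hne
    simp [hne] at hv
  have : Nonempty X := hex.elim fun v hv => ⟨(nonempty_of_pos _ hv).some⟩
  obtain ⟨s₀, hs₀, hs₀le⟩ := exists_pos_le_diam hfin
  obtain ⟨B, hB⟩ := exists_diam_lt_pow hfin hs₀ hσ1
  have hscale : ∀ v, pos v → ∃ k : ℕ, s₀ * σ ^ k ≤ Metric.diam (S (m v)) ∧
      Metric.diam (S (m v)) < s₀ * σ ^ (k + 1) := by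
    intro v hv
    obtain ⟨k, h1, h2⟩ := exists_nat_pow_near (x := Metric.diam (S (m v)) / s₀) (y := σ)
      (by rw [le_div_iff₀ hs₀, one_mul]; exact hs₀le _ hv) hσ1
    rw [le_div_iff₀' hs₀] at h1
    rw [div_lt_iff₀' hs₀] at h2
    exact ⟨k, h1, h2⟩
  choose! k hk1 hk2 using hscale
  have hkB : ∀ v, pos v → k v ≤ B := by
    intro v hv
    by_contra! hlt
    have := pow_le_pow_right₀ hσ1.le hlt.le
    nlinarith [hk1 v hv, hB (m v)]
  choose! p hp using fun v (hv : pos v) => nonempty_of_pos _ hv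
  -- Chosen so that crossing `2 * r + 1` sets, each no larger than `S (m v)`, costs at most `a * σ ^
  -- k v`.
  set a : ℝ := (2 * r + 1) * σ * s₀ with ha
  have ha0 : 0 < a := by positivity
  choose col M hM1 hM2 using fun j : ℕ =>
    exists_labelling hK (ρ := 5 * (a * σ ^ j)) (by positivity)
  set i : V → Fin (n + 1) := fun v => col (k v) (p v) with hi
  have hasc : ∀ v, pos v → ∀ c : ℝ, 0 ≤ c → c ≤ 2 * r + 1 →
      c * Metric.diam (S (m v)) ≤ a * σ ^ k v := by
    intro v hv c hc0 hc
    calc c * Metric.diam (S (m v)) ≤ (2 * r + 1) * (s₀ * σ ^ (k v + 1)) :=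
          mul_le_mul hc (hk2 v hv).le Metric.diam_nonneg (by positivity)
      _ = a * σ ^ k v := by rw [ha]; ring
  have hclose : ∀ u v, pos u → pos v → G.edist u v ≤ r → i u = i v →
      CloseAtScales a σ k p i u v := by
    intro u v hu hv huv hiuv
    refine ⟨hiuv, ?_⟩
    by_cases hvne : (S v).Nonempty
    · obtain ⟨q, hq⟩ := hvne
      have hle : ∀ z, G.edist v z ≤ r → Metric.diam (S z) ≤ Metric.diam (S (m v)) := hmax v
      have h1 : dist q (p v) ≤ (r + 1) * Metric.diam (S (m v)) :=
        dist_le_of_edist_le hb (hmd v) hle hq (hp v hv)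
      have h2 : dist (p u) q ≤ (2 * r + 1) * Metric.diam (S (m u)) := by
        obtain ⟨w₁, hw₁⟩ := SimpleGraph.exists_walk_of_edist_le (hmd u)
        obtain ⟨w₂, hw₂⟩ := SimpleGraph.exists_walk_of_edist_le huv
        refine (dist_le_of_walk hb (θ := Metric.diam (S (m u))) (w₁.reverse.append w₂)
          (fun z hz => ?_) (hp u hu) hq).trans ?_
        · rw [SimpleGraph.Walk.mem_support_append_iff, SimpleGraph.Walk.support_reverse,
            List.mem_reverse] at hz
          rcases hz with hz | hz
          · exact hmax u z ((edist_le_of_mem_support w₁ hz).trans (by exact_mod_cast hw₁))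
          · exact hmax u z ((edist_le_of_mem_support w₂ hz).trans (by exact_mod_cast hw₂))
        · rw [SimpleGraph.Walk.length_append, SimpleGraph.Walk.length_reverse]
          refine mul_le_mul_of_nonneg_right ?_ Metric.diam_nonneg
          have : ((w₁.length + w₂.length : ℕ) : ℝ) ≤ ((2 * r : ℕ) : ℝ) := by
            exact_mod_cast (by omega)
          push_cast at this ⊢
          linarith
      have h3 := hasc u hu (2 * r + 1) (by positivity) le_rfl
      have h4 := hasc v hv (r + 1) (by positivity) (by linarith [(Nat.cast_nonneg r : (0:ℝ) ≤ r)])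
      linarith [dist_triangle (p u) q (p v)]
    · have huv' : v = u := by
        obtain ⟨w, _⟩ := SimpleGraph.exists_walk_of_edist_le (edist_le_symm huv)
        cases w with
        | nil => rfl
        | cons h _ => exact absurd (h.2.mono Set.inter_subset_left) hvne
      subst huv'
      rw [dist_self]
      positivity
  have closeSymm : ∀ x y, CloseAtScales a σ k p i x y → CloseAtScales a σ k p i y x :=
    fun x y h => ⟨h.1.symm, by rw [dist_comm, add_comm]; exact h.2⟩
  -- The witness `u` lets linked vertices of different scales share a bag, and its largest neighbour
  -- `m u` provides a set of diameter at least the scale `j` near `v`.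
  set P : V → ℕ → Prop := fun v j => pos v ∧ ∃ u, pos u ∧ G.edist v u ≤ r ∧ i v = i u ∧ j ≤ k u
    with hPdef
  let F := scaleForest k (CloseAtScales a σ k p i) P B
    (by rintro v j ⟨_, u, hu, _, _, hj⟩; exact hj.trans (hkB u hu))
    (by rintro v j₁ j₂ hj ⟨hv, u, hu, h1, h2, h3⟩; exact ⟨hv, u, hu, h1, h2, hj.trans h3⟩)
  have hcov : F.Covered G N (4 * r + 1) := by
    rintro ⟨j, A⟩
    by_cases hne : ∃ v, v ∈ F.bag (j, A)
    swap
    · exact ⟨∅, by simp, fun v hv => absurd ⟨v, hv⟩ hne⟩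
    obtain ⟨v₀, hv₀⟩ := hne
    set θ : ℝ := s₀ * σ ^ j with hθ
    have hθ0 : 0 < θ := by positivity
    have hbig : ∀ v ∈ F.bag (j, A), ∃ w, G.edist v w ≤ (4 * r : ℕ) ∧ θ ≤ Metric.diam (S w) ∧
        ∃ q ∈ S w, dist q (p v₀) ≤ ((3 * r : ℕ) + (2 * r + 1) * σ * σ) * θ := by
      rintro v ⟨hA, -, hv, u, hu, hvu, -, hju⟩
      obtain ⟨w₁, hw₁⟩ := SimpleGraph.exists_walk_of_edist_le (hmd v)
      obtain ⟨w₂, hw₂⟩ := SimpleGraph.exists_walk_of_edist_le hvu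
      obtain ⟨w₃, hw₃⟩ := SimpleGraph.exists_walk_of_edist_le (hmd u)
      have hmu : θ ≤ Metric.diam (S (m u)) := (mul_le_mul_of_nonneg_left
        (pow_le_pow_right₀ hσ1.le hju) hs₀.le).trans (hk1 u hu)
      have hlen : ((w₁.reverse.append w₂).append w₃).length ≤ 3 * r := by
        rw [SimpleGraph.Walk.length_append, SimpleGraph.Walk.length_append,
          SimpleGraph.Walk.length_reverse]
        omega
      obtain ⟨z, hz, hzd, q, hq, hqp⟩ := exists_large_on_walk hb hθ0.le
        ((w₁.reverse.append w₂).append w₃) hmu (hp v hv)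
      refine ⟨z, ?_, hzd, q, hq, ?_⟩
      · exact edist_le_mono (edist_le_add (hmd v) (edist_le_mono hz hlen)) (by omega)
      · have hmem : v₀ ∈ scaleCluster k (CloseAtScales a σ k p i) j v := by
          have h1 : A = scaleCluster k (CloseAtScales a σ k p i) j v := hA
          have h2 : A = scaleCluster k (CloseAtScales a σ k p i) j v₀ := hv₀.1
          rw [← h1, h2]
          exact Relation.ReflTransGen.refl
        have hd := dist_le_of_chain_closeAtScales ha0 hL0 le_rfl hM1 hM2 (j + 1) hmem
        have h1 : a * σ ^ (j + 1) = (2 * r + 1) * σ * σ * θ := by rw [ha, hθ]; ring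
        have h2 : (((w₁.reverse.append w₂).append w₃).length : ℝ) * θ ≤ (3 * r : ℕ) * θ := by
          gcongr
        rw [add_mul]
        linarith [dist_triangle q (p v) (p v₀)]
    choose! w hwd hwθ hwq using hbig
    obtain ⟨W, hWN, hW⟩ := exists_dominating_finset (S := S) (W := w '' F.bag (j, A)) (N := N) (by
      intro E hE hdisj
      refine hN θ hθ0 (p v₀) S E (fun z hz => ?_) hdisj
      obtain ⟨v, hv, rfl⟩ := hE z hz
      exact ⟨hS _, hwθ v hv, hwq v hv⟩)
    refine ⟨W, hWN, fun v hv => ?_⟩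
    obtain ⟨f, hf, hfd⟩ := hW _ ⟨v, hv, rfl⟩
    exact ⟨f, hf, edist_le_add (hwd v hv) hfd⟩
  obtain ⟨c, hc⟩ := hD V (ℕ × Set V) F G hcov
  -- The common bag is that of the cluster of `v` at the larger scale `k v`, where `v` witnesses
  -- that `u` is still present.
  have hlink : ∀ u v, pos u → pos v → G.edist u v ≤ r → i u = i v → k u ≤ k v →
      F.Linked G r u v := by
    intro u v hu hv huv hiuv hk
    refine ⟨⟨(k v, scaleCluster k (CloseAtScales a σ k p i) (k v) v), ⟨?_, hk, hu, v, hv, huv,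
      hiuv, le_rfl⟩, ⟨rfl, le_rfl, hv, v, hv, by simp, rfl, le_rfl⟩⟩, huv⟩
    refine scaleCluster_eq_of_mem closeSymm (Relation.ReflTransGen.single ⟨?_, ?_, ?_⟩)
    · exact closeSymm _ _ (hclose u v hu hv huv hiuv)
    · exact Nat.lt_succ_self _
    · exact Nat.lt_succ_of_le hk
  refine ⟨fun v => (i v, c v), fun u v huv => ?_⟩
  by_cases hu : pos u
  · refine hc u v ?_
    suffices h : pos v ∧ Relation.ReflTransGen (fun x y => F.Linked G r x y ∧ c x = c y) u v from
      h.2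
    induction huv with
    | refl => exact ⟨hu, .refl⟩
    | @tail x y _ hxy ih =>
      obtain ⟨hd, hcol⟩ := hxy
      rw [Prod.mk.injEq] at hcol
      have hy : pos y := by
        by_contra hy
        exact hy (isolated y x hy (edist_le_symm hd) ▸ ih.1)
      refine ⟨hy, ih.2.tail ⟨?_, hcol.2⟩⟩
      rcases le_total (k x) (k y) with hk | hk
      · exact hlink x y ih.1 hy hd hcol.1 hk
      · exact (hlink y x hy ih.1 (edist_le_symm hd) hcol.1.symm hk).symm
  · have : u = v := by
      induction huv with
      | refl => rfl
      | tail _ h ih => exact ih.trans (isolated _ _ (ih ▸ hu) h.1)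
    simp [this]

/-- Bounded colourings for arbitrary systems of round sets. -/
theorem exists_isChainBounded_of_isRound (hX : IsDoublingSpace X) {η : ℝ} (hη : 0 < η) {n : ℕ}
    {K : ℝ≥0} (hK : IsControlFunction X n fun r => K * r) (r : ℕ) :
    ∃ D : ℕ, ∀ (V : Type u) (S : V → Set X), (∀ v, IsRound η (S v)) → Function.Injective S →
      ∃ c : V → Fin (n + 1) × Bool, (familyGraph S).IsChainBounded r D c := by
  obtain ⟨D, hD⟩ := exists_isChainBounded_of_finite_range hX hη hK r
  refine ⟨D, fun V S hS hinj => exists_isChainBounded_of_finset S r D fun A => ?_⟩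
  have hmem : ∀ v, v ∈ A → {x | x ∈ S v ∧ v ∈ A} = S v := fun v hv => by simp [hv]
  have hnot : ∀ v, v ∉ A → {x | x ∈ S v ∧ v ∈ A} = ∅ := fun v hv => by simp [hv]
  refine hD V _ (fun v => ?_) (fun u v hne h => ?_) ?_
  · by_cases hv : v ∈ A
    · rw [hmem v hv]; exact hS v
    · rw [hnot v hv]
      exact ⟨Bornology.isBounded_empty, fun v hv => absurd hv (Set.notMem_empty v)⟩
  · obtain ⟨x, hx⟩ := hne
    have hx' : x ∈ {x | x ∈ S v ∧ v ∈ A} := h ▸ hx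
    rw [hmem u hx.2, hmem v hx'.2] at h
    exact hinj h
  · refine ((A.finite_toSet.image fun v => Metric.diam (S v)).union (Set.finite_singleton 0)).subset
      ?_
    rintro _ ⟨v, rfl⟩
    by_cases hv : v ∈ A
    · simp only [hmem v hv]
      exact Or.inl ⟨v, hv, rfl⟩
    · simp only [hnot v hv]
      exact Or.inr Metric.diam_empty

end RoundSystems

/-! ### Doubling spaces have linear control functions -/

section Doubling

variable {X : Type*} [MetricSpace X]

theorem exists_maximal_separated (δ : ℝ) (Y : Set X) :
    ∃ Z ⊆ Y, (Z.Pairwise fun x y => δ < dist x y) ∧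
      ∀ y ∈ Y, y ∉ Z → ∃ z ∈ Z, dist y z ≤ δ := by
  obtain ⟨Z, hZ⟩ := zorn_subset {Z : Set X | Z ⊆ Y ∧ Z.Pairwise fun x y => δ < dist x y} (by
    intro c hc hchain
    refine ⟨⋃₀ c, ⟨Set.sUnion_subset fun s hs => (hc hs).1, ?_⟩,
      fun s hs => Set.subset_sUnion_of_mem hs⟩
    exact (Set.pairwise_sUnion hchain.directedOn).2 fun s hs => (hc hs).2)
  refine ⟨Z, hZ.prop.1, hZ.prop.2, fun y hy hyZ => ?_⟩
  by_contra! hfar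
  refine hyZ (hZ.le_of_ge (y := insert y Z) ⟨Set.insert_subset hy hZ.prop.1, ?_⟩
    (Set.subset_insert y Z) (Set.mem_insert y Z))
  refine hZ.prop.2.insert fun z hz _ => ⟨hfar z hz, ?_⟩
  rw [dist_comm]
  exact hfar z hz

/-- Split a maximal `r`-separated net greedily into `4 * r`-separated subsets, each maximal in what
remains. A net point left over after `n + 1` rounds would have a distinct net point within `4 * r`
from every round, against the packing bound `n`. The balls of radius `2 * r` around the net points
form the cover. -/
theorem exists_isControlFunction_of_doubling (hX : IsDoublingSpace X) :
    ∃ n : ℕ, IsControlFunction X n fun r => 4 * r := by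
  obtain ⟨n, hn⟩ := exists_card_bound_of_doubling.{0} hX one_pos 4
  refine ⟨n, fun r hr => ?_⟩
  have hr' : (0 : ℝ) < r := by exact_mod_cast hr
  obtain ⟨Z, -, hZ, hZnet⟩ := exists_maximal_separated (r : ℝ) (Set.univ : Set X)
  choose f hfsub hfsep hfmax using exists_maximal_separated (X := X) (4 * r)
  let Y : ℕ → Set X := fun t => Nat.rec Z (fun _ Y => Y \ f Y) t
  have hYanti : Antitone Y := antitone_nat_of_succ_le fun t => Set.sdiff_subset
  have hexhaust : ∀ z ∈ Z, ∃ t : Fin (n + 1), z ∈ f (Y t) := by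
    intro z hz
    by_contra! hcon
    have hzY : ∀ t, t ≤ n + 1 → z ∈ Y t := by
      intro t
      induction t with
      | zero => exact fun _ => hz
      | succ t ih => exact fun ht => ⟨ih (by omega), hcon ⟨t, by omega⟩⟩
    have hc : ∀ t ∈ Finset.range (n + 1), ∃ c ∈ f (Y t), dist z c ≤ 4 * r := fun t ht =>
      hfmax _ z (hzY t (Finset.mem_range.1 ht).le) (hcon ⟨t, Finset.mem_range.1 ht⟩)
    have : Nonempty X := ⟨z⟩
    choose! c hcf hcd using hc
    have hlt : ∀ s t, t ∈ Finset.range (n + 1) → s ∈ Finset.range (n + 1) → s < t → c s ≠ c t := by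
      intro s t ht hs hst heq
      have h1 : c t ∈ Y (s + 1) := hYanti hst (hfsub _ (hcf t ht))
      exact h1.2 (heq ▸ hcf s hs)
    have hcZ : ∀ t ∈ Finset.range (n + 1), c t ∈ Z := fun t ht =>
      hYanti (Nat.zero_le t) (hfsub _ (hcf t ht))
    have hcard := hn r hr' z (Finset.range (n + 1)) c
      (fun t ht => by rw [dist_comm]; exact hcd t ht) (fun s hs t ht hst => by
        rw [one_mul]
        refine hZ (hcZ s hs) (hcZ t ht) ?_
        rcases lt_or_gt_of_ne hst with h | h
        · exact hlt s t ht hs h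
        · exact (hlt t s hs ht h).symm)
    rw [Finset.card_range] at hcard
    omega
  have hnet : ∀ x : X, ∃ z ∈ Z, dist x z ≤ r := by
    intro x
    by_cases hx : x ∈ Z
    · exact ⟨x, hx, by simp⟩
    · exact hZnet x trivial hx
  have hball : ∀ x : X, ∃ U ∈ ⋃ t : Fin (n + 1), (fun c => Metric.closedBall c (2 * r)) '' f (Y t),
      Metric.closedEBall x (r : ℝ≥0∞) ⊆ U := by
    intro x
    obtain ⟨z, hz, hxz⟩ := hnet x
    obtain ⟨t, ht⟩ := hexhaust z hz
    refine ⟨_, Set.mem_iUnion.2 ⟨t, z, ht, rfl⟩, fun y hy => ?_⟩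
    rw [Metric.mem_closedEBall, edist_nndist] at hy
    have hy' : nndist y x ≤ r := by exact_mod_cast hy
    have hy'' : dist y x ≤ r := by exact_mod_cast hy'
    rw [Metric.mem_closedBall]
    linarith [dist_triangle y x z]
  refine ⟨fun t => (fun c => Metric.closedBall c (2 * r)) '' f (Y t), ?_, ?_, ?_,
    le_iSup₂_of_le r hball le_rfl⟩
  · refine Set.eq_univ_of_forall fun x => ?_
    obtain ⟨U, hU, hsub⟩ := hball x
    exact ⟨U, hU, hsub (by simp)⟩
  · rintro t _ ⟨c, hc, rfl⟩ _ ⟨d, hd, rfl⟩ hne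
    refine Metric.closedBall_disjoint_closedBall ?_
    have := hfsep _ hc hd (fun h => hne (by rw [h]))
    linarith
  · refine iSup₂_le fun U hU => ?_
    obtain ⟨t, c, -, rfl⟩ := Set.mem_iUnion.1 hU
    refine Metric.ediam_le fun x hx y hy => ?_
    rw [edist_nndist]
    have : dist x y ≤ 4 * r := by
      rw [Metric.mem_closedBall] at hx hy
      linarith [dist_triangle_right x y c]
    have : nndist x y ≤ 4 * r := by exact_mod_cast this
    exact_mod_cast this

end Doubling

/-! ### Asymptotic dimension of intersection graphs of round sets -/

theorem asymptoticDim_roundIntersectionGraphs_le {X : Type u} [MetricSpace X]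
    (hX : IsDoublingSpace X) {η : ℝ} (hη : 0 < η) {n : ℕ} {K : ℝ≥0}
    (hK : IsControlFunction X n fun r => K * r) :
    asymptoticDim (roundIntersectionGraphs X η) ≤ ((2 * n + 1 : ℕ) : ℕ∞) := by
  choose D hD using exists_isChainBounded_of_isRound hX hη hK
  refine iInf₂_le (2 * n + 1) ⟨fun r => ((D (2 * ⌈r⌉₊) + 2 * ⌈r⌉₊ : ℕ) : ℝ≥0), ?_⟩
  rintro _ ⟨𝒮, h𝒮, rfl⟩
  refine isControlFunction_of_isChainBounded (intersectionGraph 𝒮) fun R => ?_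
  obtain ⟨c, hc⟩ := hD R 𝒮 Subtype.val (fun v => h𝒮 v v.2) Subtype.val_injective
  have hgraph : familyGraph (Subtype.val : 𝒮 → Set X) = intersectionGraph 𝒮 := rfl
  have hcard : (n + 1) * 2 = 2 * n + 1 + 1 := by ring
  let e : Fin (n + 1) × Bool ≃ Fin (2 * n + 1 + 1) :=
    Fintype.equivFinOfCardEq (by simp [hcard])
  refine ⟨e ∘ c, fun u v huv => ?_⟩
  rw [← hgraph] at huv ⊢
  refine hc u v ?_
  simpa only [Function.comp_apply, e.injective.eq_iff] using huv

theorem corollary3 {X : Type u} [MetricSpace X] (hX : IsDoublingSpace X) (η : ℝ) (hη : 0 < η) :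
    asymptoticDim (roundIntersectionGraphs X η) ≠ ⊤ ∧
      ∀ n : ℕ, assouadNagataDim X = (n : ℕ∞) →
        asymptoticDim (roundIntersectionGraphs X η) ≤ ((2 * n + 1 : ℕ) : ℕ∞) := by
  constructor
  · obtain ⟨n, hn⟩ := exists_isControlFunction_of_doubling hX
    exact ne_top_of_le_ne_top (ENat.natCast_ne_top _)
      (asymptoticDim_roundIntersectionGraphs_le hX hη hn)
  · intro n hn
    -- Comparing the infimum strictly with `n + 1` extracts an actual dimension `m ≤ n` with a
    -- linear control function.
    have hlt : assouadNagataDim X < ((n + 1 : ℕ) : ℕ∞) := by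
      rw [hn]
      exact_mod_cast Nat.lt_succ_self n
    obtain ⟨m, hm⟩ := iInf_lt_iff.1 hlt
    obtain ⟨⟨K, -, hK⟩, hm⟩ := iInf_lt_iff.1 hm
    have hmn : m ≤ n := Nat.lt_succ_iff.1 (by exact_mod_cast hm)
    exact (asymptoticDim_roundIntersectionGraphs_le hX hη hK).trans (by exact_mod_cast (by omega))
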